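/- Let $k$ be an arbitrary field. An endomorphism of $\mathbb{A}^n=\mathbb{A}^n_k$ ($n\ge 1$) is a tuple $f=(f_1,\dots,f_n)$ with $f_i\in k[x_1,\dots,x_n]$; its degree is $\deg f=\max_i\deg f_i$, and it is an automorphism if it is invertible under composition. An automorphism $f$ of $\mathbb{A}^n$ is called affine-triangular if $f=\alpha\circ\tau$, where $\alpha$ is an affine automorphism (an automorphism of degree $1$) and $\tau=(\tau_1,\dots,\tau_n)$ is triangular, i.e. $\tau_i\in k[x_1,\dots,x_i]$ for every $i$. The dynamical degree of $f$ is $\lambda(f)=\lim_{r\to\infty}\deg(f^r)^{1/r}$. A weak Perron number is a real algebraic integer $\lambda\ge 1$ such that all other Galois conjugates $\mu\in\mathbb{C}$ of $\lambda$ satisfy $|\mu|\le\lambda$. Theorem. Each weak Perron number $\lambda$ is the dynamical degree of an affine-triangular automorphism of $\mathbb{A}^n$ over $k$ for some integer $n\ge 1$. Moreover: 1. If $\lambda>1$ is an integer, the least possible $n$ is $2$. 2. If $\lambda$ is a quadratic integer (an algebraic integer of degree $2$ over $\mathbb{Q}$) and its Galois conjugate is negative, the least possible $n$ is $3$. 3.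 If $\lambda$ is a quadratic integer and its Galois conjugate is positive, the least possible $n$ is $4$. -/

import Mathlib

namespace AffineDyn

/-- Endomorphisms of affine `n`-space over `k`, as `n`-tuples of polynomials in `n` variables. -/
abbrev PolyEnd (k : Type*) [Field k] (n : ℕ) : Type _ :=
  Fin n → MvPolynomial (Fin n) k

namespace PolyEnd

variable {k : Type*} [Field k] {n : ℕ}

/-- The identity `(x₁, …, xₙ)`. -/
noncomputable def one (k : Type*) [Field k] (n : ℕ) : PolyEnd k n :=
  fun i => MvPolynomial.X i

/-- The composition `f ∘ g`, with components `fᵢ(g₁, …, gₙ)`. -/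
noncomputable def comp (f g : PolyEnd k n) : PolyEnd k n :=
  fun i => MvPolynomial.bind₁ g (f i)

/-- The `r`-fold composition of `f` with itself. -/
noncomputable def iter (f : PolyEnd k n) : ℕ → PolyEnd k n
  | 0 => one k n
  | r + 1 => comp f (iter f r)

/-- The maximum of the degrees of the components. -/
noncomputable def degree (f : PolyEnd k n) : ℕ :=
  Finset.univ.sup fun i => (f i).totalDegree

/-- `f` is invertible for the composition. -/
def IsAut (f : PolyEnd k n) : Prop :=
  ∃ g : PolyEnd k n, comp f g = one k n ∧ comp g f = one k n

/-- `fᵢ ∈ k[x₁, …, xᵢ]` for each `i`. -/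
def IsTriangular (f : PolyEnd k n) : Prop :=
  ∀ i, f i ∈ MvPolynomial.supported k (Set.Iic i)

/-- Affine automorphisms: the automorphisms of degree `1`. -/
def IsAffineAut (f : PolyEnd k n) : Prop :=
  IsAut f ∧ degree f = 1

/-- `f = α ∘ τ` with `α` an affine automorphism and `τ` a triangular endomorphism. -/
def IsAffineTriangular (f : PolyEnd k n) : Prop :=
  ∃ α τ : PolyEnd k n, IsAffineAut α ∧ IsTriangular τ ∧ f = comp α τ

/-- The dynamical degree of `f` exists and equals `l`: `deg(f^r)^(1/r) → l` as `r → ∞`. -/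
def HasDynamicalDegree (f : PolyEnd k n) (l : ℝ) : Prop :=
  Filter.Tendsto (fun r : ℕ => ((iter f r).degree : ℝ) ^ (1 / (r : ℝ)))
    Filter.atTop (nhds l)

end PolyEnd

/-- The set of `n ≥ 1` such that `l` is the dynamical degree of an affine-triangular
automorphism of affine `n`-space over `k`. -/
def realizingDims (k : Type*) [Field k] (l : ℝ) : Set ℕ :=
  {n | 1 ≤ n ∧ ∃ f : PolyEnd k n, f.IsAut ∧ f.IsAffineTriangular ∧ f.HasDynamicalDegree l}

/-- `μ ∈ ℂ` is a Galois conjugate (over `ℚ`) of the algebraic real number `l`. -/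
def IsConjugateOf (μ : ℂ) (l : ℝ) : Prop :=
  Polynomial.aeval μ (minpoly ℚ l) = 0

/-- A real algebraic integer `l ≥ 1` all of whose other Galois conjugates `μ ∈ ℂ` satisfy
`|μ| ≤ l`. -/
def IsWeakPerron (l : ℝ) : Prop :=
  1 ≤ l ∧ IsIntegral ℤ l ∧ ∀ μ : ℂ, IsConjugateOf μ l → μ ≠ (l : ℂ) → ‖μ‖ ≤ l

/-- An algebraic integer of degree `2` over `ℚ`. -/
def IsQuadraticInteger (l : ℝ) : Prop :=
  IsIntegral ℤ l ∧ (minpoly ℚ l).natDegree = 2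

end AffineDyn

/-!
Let the variables have positive weights `wᵢ`. If every monomial of `fᵢ` has weight at most `t wᵢ`,
then `deg (f ^ r)` is at most a multiple of `t ^ r`. If moreover the endomorphism formed by the
parts of `fᵢ` of weight `t wᵢ` has nonzero iterates, then `deg (f ^ r)` is also at least a positive
multiple of `t ^ r`, and the dynamical degree of `f` is `t`.

A weak Perron number `l > 1` has a power `l ^ m` that is fixed or made smaller in absolute value by
each complex embedding of `ℚ(l)`. In `ℤ[l ^ m]`, the positive elements that dominate their
conjugates are sums of finitely many such elements, so that `l` has a positive eigenvector for a
matrix with natural entries. The eigenvector provides the weights for an automorphism of the form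
`(y + monomials in x, x)`.

By Gaussian elimination, an affine-triangular automorphism is conjugate to a triangular automorphism
followed by a permutation of the coordinates. In dimension at most three, going through the
permutations and choosing suitable weights shows that a dynamical degree `l > 1` is an integer in
dimension two, and satisfies `l ^ 2 = i l + j` with natural `i`, `j` in dimension three. A quadratic
integer that satisfies such an equation has norm `-j`, and cannot have a positive conjugate.
-/

namespace AffineDyn

open MvPolynomial

namespace PolyEnd

section Composition

variable {k : Type*} [Field k] {n : ℕ}

theorem comp_assoc (f g h : PolyEnd k n) : comp (comp f g) h = comp f (comp g h) := by
  funext i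
  simp only [comp, bind₁_bind₁]
  rfl

@[simp]
theorem one_comp (f : PolyEnd k n) : comp (one k n) f = f :=
  funext fun i => by simp [comp, one]

@[simp]
theorem bind₁_one (p : MvPolynomial (Fin n) k) : bind₁ (one k n) p = p :=
  congrArg (fun φ : MvPolynomial (Fin n) k →ₐ[k] _ => φ p) bind₁_X_left

@[simp]
theorem comp_one (f : PolyEnd k n) : comp f (one k n) = f := by
  funext i
  exact bind₁_one (f i)

theorem bind₁_comp (f g : PolyEnd k n) (p : MvPolynomial (Fin n) k) :
    bind₁ (comp f g) p = bind₁ g (bind₁ f p) := by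
  rw [bind₁_bind₁]
  rfl

theorem leftInverse_bind₁ {f g : PolyEnd k n} (h : comp f g = one k n) :
    Function.LeftInverse (bind₁ g) (bind₁ f) := fun p => by
  rw [← bind₁_comp, h, bind₁_one]

theorem IsAut.comp {f g : PolyEnd k n} (hf : IsAut f) (hg : IsAut g) :
    IsAut (PolyEnd.comp f g) := by
  obtain ⟨f', hff', hf'f⟩ := hf
  obtain ⟨g', hgg', hg'g⟩ := hg
  refine ⟨PolyEnd.comp g' f', ?_, ?_⟩
  · rw [comp_assoc, ← comp_assoc g, hgg', one_comp, hff']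
  · rw [comp_assoc, ← comp_assoc f', hf'f, one_comp, hg'g]

theorem iter_conj {f φ ψ : PolyEnd k n} (hψφ : comp ψ φ = one k n) (hφψ : comp φ ψ = one k n)
    (r : ℕ) : iter (comp φ (comp f ψ)) r = comp φ (comp (iter f r) ψ) := by
  induction r with
  | zero => simp [iter, hφψ]
  | succ r ih =>
    rw [iter, ih, iter]
    simp only [comp_assoc]
    rw [← comp_assoc ψ φ, hψφ, one_comp]

end Composition

end PolyEnd

section Weights

variable {R : Type*} {σ σ' : Type*}

section CommSemiring

variable [CommSemiring R] {w : σ → ℝ} {w' : σ' → ℝ}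

variable (R) in
/-- The polynomials all of whose monomials have `w`-weight in `S`. The cases of interest are
`S = {D}`, `S = Set.Iic D` and `S = Set.Iio D`, the pieces of the grading and of the filtration
defined by `w`. -/
noncomputable def restrictWeight (w : σ → ℝ) (S : Set ℝ) : Submodule R (MvPolynomial σ R) :=
  restrictSupport R {d | Finsupp.weight w d ∈ S}

theorem mem_restrictWeight {S : Set ℝ} {p : MvPolynomial σ R} :
    p ∈ restrictWeight R w S ↔ ∀ d, coeff d p ≠ 0 → Finsupp.weight w d ∈ S := by
  rw [restrictWeight, mem_restrictSupport_iff]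
  simp [Set.subset_def]

theorem restrictWeight_mono {S T : Set ℝ} (h : S ⊆ T) :
    restrictWeight R w S ≤ restrictWeight R w T :=
  restrictSupport_mono _ fun _ hd => h hd

theorem monomial_mem_restrictWeight {S : Set ℝ} {d : σ →₀ ℕ} (c : R)
    (h : Finsupp.weight w d ∈ S) : monomial d c ∈ restrictWeight R w S :=
  (monomial_mem_restrictSupport _).2 (Or.inl h)

theorem X_mem_restrictWeight {S : Set ℝ} {i : σ} (h : w i ∈ S) :
    (X i : MvPolynomial σ R) ∈ restrictWeight R w S :=
  monomial_mem_restrictWeight _ (by simpa [Finsupp.weight_single] using h)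

theorem C_mem_restrictWeight {S : Set ℝ} (c : R) (h : (0 : ℝ) ∈ S) :
    (C c : MvPolynomial σ R) ∈ restrictWeight R w S :=
  monomial_mem_restrictWeight _ (by simpa using h)

theorem mul_mem_restrictWeight {S T U : Set ℝ} {p q : MvPolynomial σ R}
    (hp : p ∈ restrictWeight R w S) (hq : q ∈ restrictWeight R w T)
    (h : ∀ a ∈ S, ∀ b ∈ T, a + b ∈ U) : p * q ∈ restrictWeight R w U := by
  classical
  rw [mem_restrictWeight] at *
  intro d hd
  rw [coeff_mul] at hd
  obtain ⟨x, hx, hne⟩ := Finset.exists_ne_zero_of_sum_ne_zero hd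
  rw [← Finset.HasAntidiagonal.mem_antidiagonal.1 hx, map_add]
  exact h _ (hp _ (left_ne_zero_of_mul hne)) _ (hq _ (right_ne_zero_of_mul hne))

theorem mul_mem_restrictWeight_Iic {D E : ℝ} {p q : MvPolynomial σ R}
    (hp : p ∈ restrictWeight R w (Set.Iic D)) (hq : q ∈ restrictWeight R w (Set.Iic E)) :
    p * q ∈ restrictWeight R w (Set.Iic (D + E)) :=
  mul_mem_restrictWeight hp hq fun _ ha _ hb => add_le_add (Set.mem_Iic.1 ha) (Set.mem_Iic.1 hb)

theorem pow_mem_restrictWeight_Iic {D : ℝ} {p : MvPolynomial σ R}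
    (hp : p ∈ restrictWeight R w (Set.Iic D)) (m : ℕ) :
    p ^ m ∈ restrictWeight R w (Set.Iic (m * D)) := by
  induction m with
  | zero => simpa using C_mem_restrictWeight (R := R) 1 (by simp)
  | succ m ih =>
    rw [pow_succ, Nat.cast_succ, add_one_mul]
    exact mul_mem_restrictWeight_Iic ih hp

theorem prod_mem_restrictWeight_Iic {ι : Type*} (s : Finset ι) {D : ι → ℝ}
    {p : ι → MvPolynomial σ R} (hp : ∀ i, p i ∈ restrictWeight R w (Set.Iic (D i))) :
    ∏ i ∈ s, p i ∈ restrictWeight R w (Set.Iic (∑ i ∈ s, D i)) := by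
  classical
  induction s using Finset.induction_on with
  | empty => exact C_mem_restrictWeight 1 (by simp)
  | insert a s ha ih =>
    rw [Finset.sum_insert ha, Finset.prod_insert ha]
    exact mul_mem_restrictWeight_Iic (hp a) ih

theorem sum_mul_mul_eq_mul_weight (w : σ → ℝ) (D : ℝ) (d : σ →₀ ℕ) :
    ∑ i ∈ d.support, (d i : ℝ) * (D * w i) = D * Finsupp.weight w d := by
  simp only [Finsupp.weight_apply, Finsupp.sum, nsmul_eq_mul, Finset.mul_sum]
  exact Finset.sum_congr rfl fun _ _ => by ring

theorem prod_pow_mem_restrictWeight_Iic {D : ℝ} {g : σ → MvPolynomial σ' R}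
    (hg : ∀ i, g i ∈ restrictWeight R w' (Set.Iic (D * w i))) (d : σ →₀ ℕ) :
    ∏ i ∈ d.support, g i ^ d i ∈ restrictWeight R w' (Set.Iic (D * Finsupp.weight w d)) := by
  rw [← sum_mul_mul_eq_mul_weight]
  exact prod_mem_restrictWeight_Iic _ fun i => pow_mem_restrictWeight_Iic (hg i) (d i)

theorem bind₁_eq_sum (g : σ → MvPolynomial σ' R) (p : MvPolynomial σ R) :
    bind₁ g p = ∑ d ∈ p.support, coeff d p • ∏ i ∈ d.support, g i ^ d i := by
  conv_lhs => rw [p.as_sum, map_sum]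
  exact Finset.sum_congr rfl fun d _ => by rw [bind₁_monomial, smul_eq_C_mul]

theorem bind₁_mem_submodule {M : Submodule R (MvPolynomial σ' R)} {g : σ → MvPolynomial σ' R}
    {p : MvPolynomial σ R} (h : ∀ d, coeff d p ≠ 0 → ∏ i ∈ d.support, g i ^ d i ∈ M) :
    bind₁ g p ∈ M := by
  rw [bind₁_eq_sum]
  exact M.sum_mem fun d hd => M.smul_mem _ (h d (mem_support_iff.1 hd))

theorem bind₁_mem_restrictWeight_Iic {D E : ℝ} (hD : 0 ≤ D) {g : σ → MvPolynomial σ' R}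
    {p : MvPolynomial σ R} (hg : ∀ i, g i ∈ restrictWeight R w' (Set.Iic (D * w i)))
    (hp : p ∈ restrictWeight R w (Set.Iic E)) :
    bind₁ g p ∈ restrictWeight R w' (Set.Iic (D * E)) :=
  bind₁_mem_submodule fun d hd => restrictWeight_mono
    (Set.Iic_subset_Iic.2 (mul_le_mul_of_nonneg_left (mem_restrictWeight.1 hp d hd) hD))
    (prod_pow_mem_restrictWeight_Iic hg d)

theorem mem_restrictWeight_one_Iic {p : MvPolynomial σ R} {N : ℕ} :
    p ∈ restrictWeight R (fun _ => (1 : ℝ)) (Set.Iic (N : ℝ)) ↔ p.totalDegree ≤ N := by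
  have weight_one (d : σ →₀ ℕ) :
      Finsupp.weight (fun _ => (1 : ℝ)) d = ((d.sum fun _ e => e : ℕ) : ℝ) := by
    simp [Finsupp.weight_apply, Finsupp.sum]
  rw [mem_restrictWeight, totalDegree, Finset.sup_le_iff]
  simp only [weight_one, Set.mem_Iic, Nat.cast_le, mem_support_iff]

theorem mul_degree_le_weight {δ : ℝ} (hw : ∀ i, δ ≤ w i) (d : σ →₀ ℕ) :
    δ * ((d.sum fun _ e => e : ℕ) : ℝ) ≤ Finsupp.weight w d := by
  simp only [Finsupp.weight_apply, Finsupp.sum, nsmul_eq_mul, Nat.cast_sum, Finset.mul_sum]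
  exact Finset.sum_le_sum fun i _ => by nlinarith [hw i, Nat.cast_nonneg (α := ℝ) (d i)]

theorem weight_le_mul_degree {B : ℝ} (hw : ∀ i, w i ≤ B) (d : σ →₀ ℕ) :
    Finsupp.weight w d ≤ B * ((d.sum fun _ e => e : ℕ) : ℝ) := by
  simp only [Finsupp.weight_apply, Finsupp.sum, nsmul_eq_mul, Nat.cast_sum, Finset.mul_sum]
  exact Finset.sum_le_sum fun i _ => by nlinarith [hw i, Nat.cast_nonneg (α := ℝ) (d i)]

theorem totalDegree_le_div_of_mem_restrictWeight {δ E : ℝ} (hδ : 0 < δ) (hw : ∀ i, δ ≤ w i)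
    (hE : 0 ≤ E) {p : MvPolynomial σ R} (hp : p ∈ restrictWeight R w (Set.Iic E)) :
    (p.totalDegree : ℝ) ≤ E / δ := by
  rw [← Nat.le_floor_iff (by positivity)]
  refine Finset.sup_le fun d hd => Nat.le_floor ?_
  rw [le_div_iff₀ hδ, mul_comm]
  exact (mul_degree_le_weight hw d).trans (mem_restrictWeight.1 hp d (mem_support_iff.1 hd))

end CommSemiring

section CommRing

variable [CommRing R] {w : σ → ℝ} {w' : σ' → ℝ}

/-- `L` is the part of `p` of weight `D`, and the other monomials of `p` have smaller weight. The
leading part `L` may be `0`. -/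
structure HasLeadingPart (w : σ → ℝ) (D : ℝ) (p L : MvPolynomial σ R) : Prop where
  leading_mem : L ∈ restrictWeight R w {D}
  sub_mem : p - L ∈ restrictWeight R w (Set.Iio D)

namespace HasLeadingPart

variable {D E : ℝ} {p q L M : MvPolynomial σ R}

theorem mem_Iic (h : HasLeadingPart w D p L) : p ∈ restrictWeight R w (Set.Iic D) := by
  have hL := restrictWeight_mono (T := Set.Iic D) (by simp) h.leading_mem
  have hrest := restrictWeight_mono (T := Set.Iic D) Set.Iio_subset_Iic_self h.sub_mem
  simpa using add_mem hrest hL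

theorem mul (hp : HasLeadingPart w D p L) (hq : HasLeadingPart w E q M) :
    HasLeadingPart w (D + E) (p * q) (L * M) where
  leading_mem := mul_mem_restrictWeight hp.leading_mem hq.leading_mem (by simp)
  sub_mem := by
    have split : p * q - L * M = (p - L) * q + L * (q - M) := by ring
    rw [split]
    exact add_mem
      (mul_mem_restrictWeight hp.sub_mem hq.mem_Iic fun a ha b hb =>
        add_lt_add_of_lt_of_le (Set.mem_Iio.1 ha) (Set.mem_Iic.1 hb))
      (mul_mem_restrictWeight hp.leading_mem hq.sub_mem fun a ha b hb =>
        add_lt_add_of_le_of_lt (le_of_eq (Set.mem_singleton_iff.1 ha)) (Set.mem_Iio.1 hb))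

theorem one (w : σ → ℝ) : HasLeadingPart w 0 (1 : MvPolynomial σ R) 1 where
  leading_mem := C_mem_restrictWeight 1 (by simp)
  sub_mem := by simp

theorem X (w : σ → ℝ) (i : σ) :
    HasLeadingPart w (w i) (X i : MvPolynomial σ R) (MvPolynomial.X i) where
  leading_mem := X_mem_restrictWeight (by simp)
  sub_mem := by simp

theorem pow (h : HasLeadingPart w D p L) (m : ℕ) :
    HasLeadingPart w (m * D) (p ^ m) (L ^ m) := by
  induction m with
  | zero => simpa using HasLeadingPart.one w
  | succ m ih =>
    rw [pow_succ, pow_succ, Nat.cast_succ, add_one_mul]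
    exact ih.mul h

theorem prod {ι : Type*} (s : Finset ι) {D : ι → ℝ} {p L : ι → MvPolynomial σ R}
    (h : ∀ i, HasLeadingPart w (D i) (p i) (L i)) :
    HasLeadingPart w (∑ i ∈ s, D i) (∏ i ∈ s, p i) (∏ i ∈ s, L i) := by
  classical
  induction s using Finset.induction_on with
  | empty => simpa using HasLeadingPart.one w
  | insert a s ha ih =>
    rw [Finset.sum_insert ha, Finset.prod_insert ha, Finset.prod_insert ha]
    exact (h a).mul ih

theorem bind₁ (hD : 0 < D) {g g' : σ → MvPolynomial σ' R}
    (hg : ∀ i, HasLeadingPart w' (D * w i) (g i) (g' i)) (hp : HasLeadingPart w E p L) :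
    HasLeadingPart w' (D * E) (MvPolynomial.bind₁ g p) (MvPolynomial.bind₁ g' L) := by
  have hprod (d : σ →₀ ℕ) : HasLeadingPart w' (D * Finsupp.weight w d)
      (∏ i ∈ d.support, g i ^ d i) (∏ i ∈ d.support, g' i ^ d i) := by
    rw [← sum_mul_mul_eq_mul_weight]
    exact HasLeadingPart.prod _ fun i => (hg i).pow (d i)
  have hL (d : σ →₀ ℕ) (hd : coeff d L ≠ 0) : Finsupp.weight w d = E :=
    mem_restrictWeight.1 hp.leading_mem d hd
  refine ⟨bind₁_mem_submodule fun d hd => hL d hd ▸ (hprod d).leading_mem, ?_⟩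
  have hrest : MvPolynomial.bind₁ g (p - L) ∈ restrictWeight R w' (Set.Iio (D * E)) :=
    bind₁_mem_submodule fun d hd => restrictWeight_mono (Set.Iic_subset_Iio.2
      (mul_lt_mul_of_pos_left (mem_restrictWeight.1 hp.sub_mem d hd) hD)) (hprod d).mem_Iic
  have hlead : MvPolynomial.bind₁ g L - MvPolynomial.bind₁ g' L ∈
      restrictWeight R w' (Set.Iio (D * E)) := by
    rw [bind₁_eq_sum, bind₁_eq_sum, ← Finset.sum_sub_distrib]
    refine Submodule.sum_mem _ fun d hd => ?_
    rw [← smul_sub]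
    exact Submodule.smul_mem _ _ (hL d (mem_support_iff.1 hd) ▸ (hprod d).sub_mem)
  simpa [map_sub] using add_mem hrest hlead

theorem le_mul_totalDegree {B : ℝ} (h : HasLeadingPart w D p L) (hB : 0 ≤ B)
    (hw : ∀ i, w i ≤ B) (hL : L ≠ 0) : D ≤ B * p.totalDegree := by
  obtain ⟨d, hd⟩ := ne_zero_iff.1 hL
  have hdD : Finsupp.weight w d = D := mem_restrictWeight.1 h.leading_mem d hd
  have hdp : coeff d p ≠ 0 := by
    intro h0
    have := mem_restrictWeight.1 h.sub_mem d (by simpa [h0] using hd)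
    exact (Set.mem_Iio.1 this).ne hdD
  calc D = Finsupp.weight w d := hdD.symm
    _ ≤ B * ((d.sum fun _ e => e : ℕ) : ℝ) := weight_le_mul_degree hw d
    _ ≤ B * p.totalDegree := by
      gcongr
      exact le_totalDegree (mem_support_iff.2 hdp)

end HasLeadingPart

theorem hasLeadingPart_weightedHomogeneousComponent {D : ℝ} {p : MvPolynomial σ R}
    (hp : p ∈ restrictWeight R w (Set.Iic D)) :
    HasLeadingPart w D p (weightedHomogeneousComponent w D p) where
  leading_mem := mem_restrictWeight.2 fun _ hd => weightedHomogeneousComponent_isWeightedHomogeneous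
    D p hd
  sub_mem := by
    classical
    refine mem_restrictWeight.2 fun d hd => ?_
    rw [coeff_sub, coeff_weightedHomogeneousComponent] at hd
    split_ifs at hd with hdD
    · simp at hd
    · exact lt_of_le_of_ne (mem_restrictWeight.1 hp d (by simpa using hd)) hdD

end CommRing

end Weights

namespace PolyEnd

variable {k : Type*} [Field k] {n : ℕ}

section Degree

theorem totalDegree_le_degree (f : PolyEnd k n) (i : Fin n) : (f i).totalDegree ≤ f.degree :=
  Finset.le_sup (f := fun i => (f i).totalDegree) (Finset.mem_univ i)

theorem degree_le_of_forall_totalDegree_le {f : PolyEnd k n} {E : ℝ} (hE : 0 ≤ E)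
    (h : ∀ i, ((f i).totalDegree : ℝ) ≤ E) : (f.degree : ℝ) ≤ E := by
  rw [← Nat.le_floor_iff hE]
  exact Finset.sup_le fun i _ => Nat.le_floor (h i)

theorem totalDegree_bind₁_le (g : PolyEnd k n) (p : MvPolynomial (Fin n) k) :
    (bind₁ g p).totalDegree ≤ g.degree * p.totalDegree := by
  rw [← mem_restrictWeight_one_Iic, Nat.cast_mul]
  refine bind₁_mem_restrictWeight_Iic (w := fun _ => 1) (Nat.cast_nonneg _) (fun i => ?_)
    (mem_restrictWeight_one_Iic.2 le_rfl)
  rw [mul_one, mem_restrictWeight_one_Iic]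
  exact totalDegree_le_degree g i

theorem degree_comp_le (f g : PolyEnd k n) : (comp f g).degree ≤ f.degree * g.degree :=
  Finset.sup_le fun i _ => (totalDegree_bind₁_le g (f i)).trans <| by
    rw [mul_comm]
    exact Nat.mul_le_mul_right _ (totalDegree_le_degree f i)

theorem degree_conj_le (f φ ψ : PolyEnd k n) :
    (comp φ (comp f ψ)).degree ≤ (φ.degree * ψ.degree + 1) * f.degree :=
  calc (comp φ (comp f ψ)).degree ≤ φ.degree * (comp f ψ).degree := degree_comp_le _ _
    _ ≤ φ.degree * (f.degree * ψ.degree) := Nat.mul_le_mul_left _ (degree_comp_le _ _)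
    _ ≤ (φ.degree * ψ.degree + 1) * f.degree := by nlinarith

end Degree

section GrowthRate

open Filter Topology

theorem tendsto_mul_rpow_inv {C : ℝ} (hC : 0 < C) {u : ℕ → ℝ} (hu : ∀ r, 0 ≤ u r) {l : ℝ}
    (h : Tendsto (fun r : ℕ => u r ^ (1 / (r : ℝ))) atTop (𝓝 l)) :
    Tendsto (fun r : ℕ => (C * u r) ^ (1 / (r : ℝ))) atTop (𝓝 l) := by
  have hC1 : Tendsto (fun r : ℕ => C ^ (1 / (r : ℝ))) atTop (𝓝 1) := by
    have := (Real.continuous_const_rpow hC.ne').continuousAt.tendsto.comp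
      (tendsto_one_div_atTop_nhds_zero_nat (𝕜 := ℝ))
    simpa [Function.comp_def] using this
  simpa [Real.mul_rpow hC.le (hu _)] using hC1.mul h

theorem tendsto_mul_pow_rpow_inv {C t : ℝ} (hC : 0 < C) (ht : 0 ≤ t) :
    Tendsto (fun r : ℕ => (C * t ^ r) ^ (1 / (r : ℝ))) atTop (𝓝 t) := by
  refine tendsto_mul_rpow_inv hC (fun r => pow_nonneg ht r) (tendsto_const_nhds.congr' ?_)
  filter_upwards [eventually_ge_atTop 1] with r hr
  rw [one_div, Real.pow_rpow_inv_natCast ht (by lia)]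

theorem rpow_inv_mono {a b : ℝ} (ha : 0 ≤ a) (h : a ≤ b) (r : ℕ) :
    a ^ (1 / (r : ℝ)) ≤ b ^ (1 / (r : ℝ)) :=
  Real.rpow_le_rpow ha h (by positivity)

theorem HasDynamicalDegree.le_of_degree_le {f : PolyEnd k n} {l C t : ℝ}
    (h : f.HasDynamicalDegree l) (hC : 0 < C) (ht : 0 ≤ t)
    (hf : ∀ r, ((iter f r).degree : ℝ) ≤ C * t ^ r) : l ≤ t :=
  le_of_tendsto_of_tendsto' h (tendsto_mul_pow_rpow_inv hC ht) fun r =>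
    rpow_inv_mono (Nat.cast_nonneg _) (hf r) r

theorem HasDynamicalDegree.le_of_le_degree {f : PolyEnd k n} {l C t : ℝ}
    (h : f.HasDynamicalDegree l) (hC : 0 < C) (ht : 0 ≤ t)
    (hf : ∀ r, C * t ^ r ≤ ((iter f r).degree : ℝ)) : t ≤ l :=
  le_of_tendsto_of_tendsto' (tendsto_mul_pow_rpow_inv hC ht) h fun r =>
    rpow_inv_mono (by positivity) (hf r) r

theorem hasDynamicalDegree_of_bounds {f : PolyEnd k n} {C C' t : ℝ} (hC : 0 < C) (hC' : 0 < C')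
    (ht : 0 ≤ t) (hf : ∀ r, C * t ^ r ≤ ((iter f r).degree : ℝ))
    (hf' : ∀ r, ((iter f r).degree : ℝ) ≤ C' * t ^ r) : f.HasDynamicalDegree t :=
  tendsto_of_tendsto_of_tendsto_of_le_of_le (tendsto_mul_pow_rpow_inv hC ht)
    (tendsto_mul_pow_rpow_inv hC' ht) (fun r => rpow_inv_mono (by positivity) (hf r) r)
    fun r => rpow_inv_mono (Nat.cast_nonneg _) (hf' r) r

theorem HasDynamicalDegree.conj {f φ ψ : PolyEnd k n} {l : ℝ} (h : f.HasDynamicalDegree l)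
    (hψφ : comp ψ φ = one k n) (hφψ : comp φ ψ = one k n) :
    (comp φ (comp f ψ)).HasDynamicalDegree l := by
  set C : ℝ := ((φ.degree * ψ.degree + 1 : ℕ) : ℝ) with hC
  have hC0 : 0 < C := by positivity
  have hupper (r : ℕ) :
      ((iter (comp φ (comp f ψ)) r).degree : ℝ) ≤ C * ((iter f r).degree : ℝ) := by
    rw [iter_conj hψφ hφψ, hC]
    exact_mod_cast degree_conj_le _ _ _
  have hlower (r : ℕ) :
      C⁻¹ * ((iter f r).degree : ℝ) ≤ ((iter (comp φ (comp f ψ)) r).degree : ℝ) := by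
    have hback : iter f r = comp ψ (comp (comp φ (comp (iter f r) ψ)) φ) := by
      simp only [comp_assoc, hψφ, comp_one]
      rw [← comp_assoc, hψφ, one_comp]
    have hdeg := degree_conj_le (comp φ (comp (iter f r) ψ)) ψ φ
    rw [← hback, mul_comm ψ.degree] at hdeg
    rw [inv_mul_le_iff₀ hC0, iter_conj hψφ hφψ, hC]
    exact_mod_cast hdeg
  exact tendsto_of_tendsto_of_tendsto_of_le_of_le
    (tendsto_mul_rpow_inv (inv_pos.2 hC0) (fun _ => Nat.cast_nonneg _) h)
    (tendsto_mul_rpow_inv hC0 (fun _ => Nat.cast_nonneg _) h)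
    (fun r => rpow_inv_mono (by positivity) (hlower r) r)
    fun r => rpow_inv_mono (by positivity) (hupper r) r

end GrowthRate

section WeightedGrowth

variable {f g : PolyEnd k n} {w : Fin n → ℝ} {t : ℝ}

theorem iter_mem_restrictWeight_Iic (ht : 0 ≤ t)
    (hf : ∀ i, f i ∈ restrictWeight k w (Set.Iic (t * w i))) (r : ℕ) (i : Fin n) :
    iter f r i ∈ restrictWeight k w (Set.Iic (t ^ r * w i)) := by
  induction r generalizing i with
  | zero => exact X_mem_restrictWeight (by simp)
  | succ r ih =>
    rw [pow_succ, mul_assoc]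
    exact bind₁_mem_restrictWeight_Iic (pow_nonneg ht r) ih (hf i)

theorem exists_degree_iter_le (ht : 0 ≤ t) (hw : ∀ i, 0 < w i)
    (hf : ∀ i, f i ∈ restrictWeight k w (Set.Iic (t * w i))) :
    ∃ C : ℝ, 0 < C ∧ ∀ r, ((iter f r).degree : ℝ) ≤ C * t ^ r := by
  rcases isEmpty_or_nonempty (Fin n) with hn | hn
  · exact ⟨1, one_pos, fun r => by simpa [degree] using pow_nonneg ht r⟩
  obtain ⟨i₀, hmin⟩ := Finite.exists_min w
  obtain ⟨i₁, hmax⟩ := Finite.exists_max w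
  have := hw i₀
  have := hw i₁
  refine ⟨w i₁ / w i₀, by positivity, fun r =>
    degree_le_of_forall_totalDegree_le (by positivity) fun i => ?_⟩
  calc ((iter f r i).totalDegree : ℝ) ≤ t ^ r * w i / w i₀ :=
        totalDegree_le_div_of_mem_restrictWeight (hw i₀) hmin
          (mul_nonneg (pow_nonneg ht r) (hw i).le) (iter_mem_restrictWeight_Iic ht hf r i)
    _ ≤ t ^ r * w i₁ / w i₀ := by
      gcongr
      exact hmax i
    _ = w i₁ / w i₀ * t ^ r := by ring

theorem HasDynamicalDegree.le_of_weights {l t₀ : ℝ} (h : f.HasDynamicalDegree l) (h0 : 0 ≤ t₀)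
    (H : ∀ t > t₀, ∃ w : Fin n → ℝ, (∀ i, 0 < w i) ∧
      ∀ i, f i ∈ restrictWeight k w (Set.Iic (t * w i))) : l ≤ t₀ := by
  refine le_of_forall_gt_imp_ge_of_dense fun t ht => ?_
  obtain ⟨w, hw, hf⟩ := H t ht
  obtain ⟨C, hC, hd⟩ := exists_degree_iter_le (h0.trans ht.le) hw hf
  exact h.le_of_degree_le hC (h0.trans ht.le) hd

theorem iter_hasLeadingPart (ht : 0 < t) (hf : ∀ i, HasLeadingPart w (t * w i) (f i) (g i))
    (r : ℕ) (i : Fin n) : HasLeadingPart w (t ^ r * w i) (iter f r i) (iter g r i) := by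
  induction r generalizing i with
  | zero =>
    rw [pow_zero, one_mul]
    exact HasLeadingPart.X w i
  | succ r ih =>
    rw [pow_succ, mul_assoc]
    exact HasLeadingPart.bind₁ (pow_pos ht r) ih (hf i)

theorem exists_le_degree_iter (ht : 0 < t) (hw : ∀ i, 0 ≤ w i)
    (hf : ∀ i, HasLeadingPart w (t * w i) (f i) (g i)) {i : Fin n} (hi : 0 < w i)
    (hg : ∀ r, iter g r i ≠ 0) :
    ∃ C : ℝ, 0 < C ∧ ∀ r, C * t ^ r ≤ ((iter f r).degree : ℝ) := by
  set B : ℝ := ∑ i, w i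
  have hwB (i) : w i ≤ B := Finset.single_le_sum (fun j _ => hw j) (Finset.mem_univ i)
  have hB : 0 < B := hi.trans_le (hwB i)
  refine ⟨w i / B, by positivity, fun r => ?_⟩
  rw [div_mul_eq_mul_div, div_le_iff₀ hB]
  calc w i * t ^ r = t ^ r * w i := mul_comm _ _
    _ ≤ B * (iter f r i).totalDegree :=
      (iter_hasLeadingPart ht hf r i).le_mul_totalDegree hB.le hwB (hg r)
    _ ≤ B * (iter f r).degree := by
      gcongr
      exact totalDegree_le_degree _ i
    _ = (iter f r).degree * B := mul_comm _ _

theorem HasDynamicalDegree.le_of_leadingPart {l : ℝ} (h : f.HasDynamicalDegree l) (ht : 0 < t)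
    (hw : ∀ i, 0 ≤ w i) (hf : ∀ i, HasLeadingPart w (t * w i) (f i) (g i)) {i : Fin n}
    (hi : 0 < w i) (hg : ∀ r, iter g r i ≠ 0) : t ≤ l := by
  obtain ⟨C, hC, hd⟩ := exists_le_degree_iter ht hw hf hi hg
  exact h.le_of_le_degree hC ht.le hd

end WeightedGrowth

end PolyEnd

section OneVariable

section CommSemiring

variable {R : Type*} [CommSemiring R] {σ σ' : Type*}

theorem bind₁_mem_supported {g : σ → MvPolynomial σ' R} {S : Set σ} {T : Set σ'}
    (hg : ∀ j ∈ S, g j ∈ supported R T) {p : MvPolynomial σ R} (hp : p ∈ supported R S) :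
    bind₁ g p ∈ supported R T := by
  have : supported R S ≤ (supported R T).comap (bind₁ g) := by
    refine Algebra.adjoin_le ?_
    rintro _ ⟨j, hj, rfl⟩
    simpa using hg j hj
  exact this hp

theorem mem_supported_iff_coeff {S : Set σ} {p : MvPolynomial σ R} :
    p ∈ supported R S ↔ ∀ d, coeff d p ≠ 0 → ∀ j, d j ≠ 0 → j ∈ S := by
  rw [mem_supported]
  refine ⟨fun h d hd j hj => h ((mem_vars_iff_mem_support j).2
    ⟨d, mem_support_iff.2 hd, Finsupp.mem_support_iff.2 hj⟩), fun h j hj => ?_⟩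
  obtain ⟨d, hd, hj'⟩ := (mem_vars_iff_mem_support j).1 hj
  exact h d (mem_support_iff.1 hd) j (Finsupp.mem_support_iff.1 hj')

theorem C_mul_mem_supported {S : Set σ} (a : R) {p : MvPolynomial σ R}
    (hp : p ∈ supported R S) : C a * p ∈ supported R S :=
  mul_mem (Subalgebra.algebraMap_mem _ a) hp

theorem coeff_single_eq_zero_of_mem_supported {S : Set σ} {s : σ} (hs : s ∉ S)
    {p : MvPolynomial σ R} (hp : p ∈ supported R S) : coeff (Finsupp.single s 1) p = 0 := by
  by_contra h
  exact hs (mem_supported_iff_coeff.1 hp _ h s (by simp))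

theorem mem_supported_Iio_of_totalDegree_le_one [PartialOrder σ] {s : σ} {p : MvPolynomial σ R}
    (hd : p.totalDegree ≤ 1) (hp : p ∈ supported R (Set.Iic s))
    (hc : coeff (Finsupp.single s 1) p = 0) : p ∈ supported R (Set.Iio s) := by
  rw [mem_supported_iff_coeff] at *
  intro d hdp v hv
  refine lt_of_le_of_ne (Set.mem_Iic.1 (hp d hdp v hv)) ?_
  rintro rfl
  have hdeg : d.degree ≤ 1 := (le_totalDegree (mem_support_iff.2 hdp)).trans hd
  have hle : Finsupp.single v 1 ≤ d := Finsupp.single_le_iff.2 (Nat.one_le_iff_ne_zero.2 hv)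
  have hsplit := congrArg Finsupp.degree (add_tsub_cancel_of_le hle)
  rw [map_add, Finsupp.degree_single] at hsplit
  have hrest : d - Finsupp.single v 1 = 0 :=
    (Finsupp.degree_eq_zero_iff _).1 (by lia)
  exact hdp (by rw [← add_tsub_cancel_of_le hle, hrest, add_zero, hc])

variable [DecidableEq σ]

/-- A polynomial seen as a polynomial in the variable `s`. The coefficients are kept in
`MvPolynomial σ R`, although they do not involve `s`. -/
noncomputable def polynomialIn (s : σ) : MvPolynomial σ R →ₐ[R] Polynomial (MvPolynomial σ R) :=
  aeval fun j => if j = s then Polynomial.X else Polynomial.C (X j)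

theorem polynomialIn_X_self (s : σ) : polynomialIn (R := R) s (X s) = Polynomial.X := by
  simp [polynomialIn]

theorem polynomialIn_eq_C {s : σ} {T : Set σ} (hs : s ∉ T) {p : MvPolynomial σ R}
    (hp : p ∈ supported R T) : polynomialIn s p = Polynomial.C p := by
  induction hp using Algebra.adjoin_induction with
  | mem x hx =>
    obtain ⟨j, hj, rfl⟩ := hx
    have : j ≠ s := fun h => hs (h ▸ hj)
    simp [polynomialIn, this]
  | algebraMap r => rw [AlgHom.commutes]; rfl
  | add x y _ _ hx hy => simp [hx, hy]
  | mul x y _ _ hx hy => simp [hx, hy]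

theorem eval_polynomialIn (s : σ) (p : MvPolynomial σ R) : (polynomialIn s p).eval (X s) = p := by
  induction p using MvPolynomial.induction_on with
  | C a => simp [← MvPolynomial.algebraMap_eq]
  | add p q hp hq => simp [hp, hq]
  | mul_X p i hp =>
    rw [map_mul, Polynomial.eval_mul, hp]
    by_cases h : i = s <;> simp [polynomialIn, h]

theorem coeff_polynomialIn_mem {s : σ} {T : Set σ} {p : MvPolynomial σ R}
    (hp : p ∈ supported R (insert s T)) (m : ℕ) :
    (polynomialIn s p).coeff m ∈ supported R T := by
  induction hp using Algebra.adjoin_induction generalizing m with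
  | mem x hx =>
    obtain ⟨j, hj, rfl⟩ := hx
    by_cases h : j = s
    · rw [h, polynomialIn_X_self, Polynomial.coeff_X]
      split_ifs
      exacts [one_mem _, zero_mem _]
    · simp only [polynomialIn, aeval_X, h, if_false, Polynomial.coeff_C]
      split_ifs
      exacts [Algebra.subset_adjoin (Set.mem_image_of_mem _ (hj.resolve_left h)), zero_mem _]
  | algebraMap r =>
    rw [AlgHom.commutes, IsScalarTower.algebraMap_apply R (MvPolynomial σ R),
      Polynomial.algebraMap_apply, Polynomial.coeff_C]
    split_ifs
    exacts [Subalgebra.algebraMap_mem _ _, zero_mem _]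
  | add x y _ _ hx hy =>
    rw [map_add, Polynomial.coeff_add]
    exact add_mem (hx m) (hy m)
  | mul x y _ _ hx hy =>
    rw [map_mul, Polynomial.coeff_mul]
    exact sum_mem fun a _ => mul_mem (hx _) (hy _)

theorem bind₁_eq_eval_map_polynomialIn (g : σ → MvPolynomial σ' R) (s : σ)
    (p : MvPolynomial σ R) :
    bind₁ g p = ((polynomialIn s p).map (bind₁ g : _ →ₐ[R] _).toRingHom).eval (g s) := by
  conv_lhs => rw [← eval_polynomialIn s p]
  rw [Polynomial.eval_map, Polynomial.eval₂_eq_sum_range, Polynomial.eval_eq_sum_range, map_sum]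
  simp

theorem polynomialIn_eval {s : σ} {T : Set σ} (hs : s ∉ T) {Q : Polynomial (MvPolynomial σ R)}
    (hQ : ∀ m, Q.coeff m ∈ supported R T) (q : MvPolynomial σ R) :
    polynomialIn s (Q.eval q) = Q.comp (polynomialIn s q) := by
  rw [Polynomial.comp, Polynomial.eval₂_eq_sum_range, Polynomial.eval_eq_sum_range, map_sum]
  exact Finset.sum_congr rfl fun m _ => by rw [map_mul, map_pow, polynomialIn_eq_C hs (hQ m)]

end CommSemiring

theorem natDegree_eq_one_of_comp_eq_X {A : Type*} [CommRing A] [IsDomain A] {P Q : Polynomial A}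
    (h : P.comp Q = Polynomial.X) : P.natDegree = 1 ∧ Q.natDegree = 1 := by
  have := congrArg Polynomial.natDegree h
  rwa [Polynomial.natDegree_comp, Polynomial.natDegree_X, mul_eq_one] at this

theorem isUnit_coeff_one_of_comp_eq_X {A : Type*} [CommRing A] [IsDomain A] {P Q : Polynomial A}
    (h : P.comp Q = Polynomial.X) : IsUnit (P.coeff 1) := by
  obtain ⟨hP, hQ⟩ := natDegree_eq_one_of_comp_eq_X h
  have hlead := congrArg Polynomial.leadingCoeff h
  rw [Polynomial.leadingCoeff_X, Polynomial.leadingCoeff_comp (by lia), hP, pow_one] at hlead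
  rw [← hP]
  exact IsUnit.of_mul_eq_one _ hlead

end OneVariable

namespace PolyEnd

variable {k : Type*} [Field k] {n : ℕ}

section Triangular

variable {τ g : PolyEnd k n} {i : Fin n}

/-- Each `fᵢ` is `aᵢ xᵢ + pᵢ` with `aᵢ ∈ k` nonzero and `pᵢ` a polynomial in the previous
variables. These are the triangular automorphisms. -/
def IsDeJonquieres (f : PolyEnd k n) : Prop :=
  ∀ i, ∃ a : k, a ≠ 0 ∧ ∃ p ∈ supported k (Set.Iio i), f i = C a * X i + p

theorem IsDeJonquieres.isTriangular (hτ : IsDeJonquieres τ) : IsTriangular τ := by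
  intro i
  obtain ⟨a, -, p, hp, h⟩ := hτ i
  rw [h]
  exact add_mem (C_mul_mem_supported a (X_mem_supported.2 (Set.mem_Iic.2 le_rfl)))
    (supported_mono Set.Iio_subset_Iic_self hp)

theorem IsTriangular.coeff_polynomialIn_mem (hτ : IsTriangular τ) (i : Fin n) (m : ℕ) :
    (polynomialIn i (τ i)).coeff m ∈ supported k (Set.Iio i) :=
  AffineDyn.coeff_polynomialIn_mem (by rw [Set.Iio_insert]; exact hτ i) m

theorem IsTriangular.X_eq_comp (hτ : IsTriangular τ) (hτg : comp τ g = one k n)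
    (hg : ∀ j < i, g j ∈ supported k (Set.Iic j)) {s : Fin n} (hs : i ≤ s) :
    polynomialIn s (X i) = ((polynomialIn i (τ i)).map (bind₁ g : _ →ₐ[k] _).toRingHom).comp
      (polynomialIn s (g i)) := by
  have hXi : bind₁ g (τ i) = X i := congrFun hτg i
  rw [← hXi, bind₁_eq_eval_map_polynomialIn g i]
  refine polynomialIn_eval (T := Set.Iio i) (by simpa using hs) (fun m => ?_) _
  rw [Polynomial.coeff_map]
  exact bind₁_mem_supported (fun j hj => supported_mono
    (Set.Iic_subset_Iio.2 (Set.mem_Iio.1 hj)) (hg j hj)) (hτ.coeff_polynomialIn_mem i m)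

theorem IsTriangular.of_comp_eq_one (hτ : IsTriangular τ) (hτg : comp τ g = one k n) :
    IsTriangular g := by
  intro i
  induction i using WellFoundedLT.induction with
  | ind i ih =>
  have hdeg := (natDegree_eq_one_of_comp_eq_X
    ((hτ.X_eq_comp hτg ih le_rfl).symm.trans (polynomialIn_X_self i))).1
  rw [mem_supported]
  intro s hs
  by_contra his
  rw [Set.mem_Iic, not_le] at his
  have h := congrArg Polynomial.natDegree (hτ.X_eq_comp hτg ih his.le)
  rw [polynomialIn_eq_C (T := {i}) (by simpa using his.ne') (X_mem_supported.2 rfl),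
    Polynomial.natDegree_C, Polynomial.natDegree_comp, hdeg, one_mul] at h
  have hconst := eval_polynomialIn s (g i)
  rw [Polynomial.eq_C_of_natDegree_eq_zero h.symm, Polynomial.eval_C] at hconst
  have hgi : g i ∈ supported k {s}ᶜ := by
    rw [← hconst]
    exact AffineDyn.coeff_polynomialIn_mem (by simp [Set.insert_eq]) 0
  exact mem_supported.1 hgi hs rfl

theorem IsTriangular.isDeJonquieres (hτ : IsTriangular τ) (h : IsAut τ) : IsDeJonquieres τ := by
  obtain ⟨g, hτg, hgτ⟩ := h
  have hinv := leftInverse_bind₁ hgτ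
  intro i
  set P := polynomialIn i (τ i)
  have hcomp := (hτ.X_eq_comp hτg (fun j _ => hτ.of_comp_eq_one hτg j) le_rfl).symm.trans
    (polynomialIn_X_self i)
  have hdeg : P.natDegree = 1 := by
    rw [← (natDegree_eq_one_of_comp_eq_X hcomp).1]
    exact (Polynomial.natDegree_map_eq_of_injective hinv.injective P).symm
  have hunit : IsUnit (P.coeff 1) := by
    have := (isUnit_coeff_one_of_comp_eq_X hcomp).map (bind₁ τ)
    rw [Polynomial.coeff_map] at this
    exact hinv (P.coeff 1) ▸ this
  obtain ⟨a, ha, hPa⟩ := isUnit_iff_eq_C_of_isReduced.1 hunit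
  refine ⟨a, ha.ne_zero, P.coeff 0, hτ.coeff_polynomialIn_mem i 0, ?_⟩
  conv_lhs => rw [← eval_polynomialIn i (τ i), Polynomial.eval_eq_sum_range, hdeg]
  rw [Finset.sum_range_succ, Finset.sum_range_one, hPa]
  ring

theorem IsDeJonquieres.exists_left_inverse (hτ : IsDeJonquieres τ) :
    ∃ g : PolyEnd k n, IsDeJonquieres g ∧ comp g τ = one k n := by
  have key (i : Fin n) : ∃ q : MvPolynomial (Fin n) k,
      (∃ a : k, a ≠ 0 ∧ ∃ p ∈ supported k (Set.Iio i), q = C a * X i + p) ∧ bind₁ τ q = X i := by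
    induction i using WellFoundedLT.induction with
    | ind i ih =>
    obtain ⟨a, ha, p, hp, h⟩ := hτ i
    have : supported k (Set.Iio i) ≤ (supported k (Set.Iio i)).map (bind₁ τ) := by
      refine Algebra.adjoin_le ?_
      rintro _ ⟨j, hj, rfl⟩
      obtain ⟨q, ⟨b, -, r, hr, hq⟩, hqj⟩ := ih j hj
      refine ⟨q, ?_, hqj⟩
      rw [hq]
      exact add_mem (C_mul_mem_supported b (X_mem_supported.2 hj))
        (supported_mono (Set.Iio_subset_Iio (le_of_lt hj)) hr)
    obtain ⟨p', hp', hτp'⟩ := this hp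
    change bind₁ τ p' = p at hτp'
    refine ⟨C a⁻¹ * X i + C (-a⁻¹) * p',
      ⟨a⁻¹, inv_ne_zero ha, _, C_mul_mem_supported _ hp', rfl⟩, ?_⟩
    have hCa : (C a⁻¹ * C a : MvPolynomial (Fin n) k) = 1 := by
      rw [← C_mul, inv_mul_cancel₀ ha, C_1]
    simp only [map_add, map_mul, bind₁_C_right, bind₁_X_right, hτp', h]
    rw [C_neg]
    linear_combination X i * hCa
  choose g hg hgτ using key
  exact ⟨g, hg, funext hgτ⟩

theorem IsDeJonquieres.isAut (hτ : IsDeJonquieres τ) : IsAut τ := by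
  obtain ⟨g, hg, hgτ⟩ := hτ.exists_left_inverse
  obtain ⟨g', -, hg'g⟩ := hg.exists_left_inverse
  have : g' = τ := by
    have := comp_assoc g' g τ
    rwa [hgτ, hg'g, one_comp, comp_one, eq_comm] at this
  exact ⟨g, this ▸ hg'g, hgτ⟩

end Triangular

section Permutation

/-- The automorphism `(x_{π 1}, …, x_{π n})` that permutes the coordinates. -/
noncomputable def perm (k : Type*) [Field k] (π : Equiv.Perm (Fin n)) : PolyEnd k n :=
  fun i => X (π i)

theorem perm_comp (π : Equiv.Perm (Fin n)) (f : PolyEnd k n) :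
    comp (perm k π) f = fun i => f (π i) := by
  funext i
  simp [comp, perm]

theorem perm_isAut (π : Equiv.Perm (Fin n)) : IsAut (perm k π) := by
  refine ⟨perm k π.symm, ?_, ?_⟩ <;> rw [perm_comp] <;> funext i <;> simp [perm, one]

theorem perm_isAffineAut (hn : 1 ≤ n) (π : Equiv.Perm (Fin n)) : IsAffineAut (perm k π) := by
  have : Nonempty (Fin n) := ⟨⟨0, hn⟩⟩
  refine ⟨perm_isAut π, ?_⟩
  simp [degree, perm, Finset.sup_const]

end Permutation

section NormalForm

variable {α : PolyEnd k n}

theorem exists_mem_vars_mem_supported_Iic {p : MvPolynomial (Fin n) k} (hp : p.vars.Nonempty) :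
    ∃ s ∈ p.vars, p ∈ supported k (Set.Iic s) :=
  ⟨p.vars.max' hp, p.vars.max'_mem hp, mem_supported.2 fun v hv => p.vars.le_max' v hv⟩

/-- `L` is `xᵢ` plus an affine combination of the previous variables, so that `bind₁ α L` is the
`i`-th row of the affine endomorphism `α` after an elementary row operation. -/
def IsRowOperation (i : Fin n) (L : MvPolynomial (Fin n) k) : Prop :=
  L - X i ∈ supported k (Set.Iio i) ∧ L.totalDegree ≤ 1

namespace IsRowOperation

variable {i j : Fin n} {L M : MvPolynomial (Fin n) k}

theorem mem_supported_Iio (hL : IsRowOperation i L) (hij : i < j) :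
    L ∈ supported k (Set.Iio j) := by
  simpa using add_mem (supported_mono (Set.Iio_subset_Iio hij.le) hL.1)
    (X_mem_supported.2 (Set.mem_Iio.2 hij))

theorem sub_C_mul (hM : IsRowOperation j M) (hL : IsRowOperation i L) (hij : i < j) (c : k) :
    IsRowOperation j (M - C c * L) := by
  constructor
  · rw [sub_right_comm]
    exact sub_mem hM.1 (C_mul_mem_supported c (hL.mem_supported_Iio hij))
  · rw [← smul_eq_C_mul]
    exact (totalDegree_sub _ _).trans (max_le hM.2 ((totalDegree_smul_le _ _).trans hL.2))

theorem totalDegree_bind₁_le_one (hL : IsRowOperation i L) (hα : IsAffineAut α) :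
    (bind₁ α L).totalDegree ≤ 1 := by
  simpa [hα.2] using (totalDegree_bind₁_le α L).trans (Nat.mul_le_mul_left _ hL.2)

theorem vars_bind₁_nonempty (hL : IsRowOperation i L) (hα : IsAut α) :
    (bind₁ α L).vars.Nonempty := by
  rw [Finset.nonempty_iff_ne_empty]
  intro hvars
  obtain ⟨β, hαβ, -⟩ := hα
  have hLc : L = C (coeff 0 (bind₁ α L)) := by
    conv_lhs => rw [← leftInverse_bind₁ hαβ L, vars_eq_empty_iff_eq_C.1 hvars, bind₁_C_right]
  have h0 := coeff_single_eq_zero_of_mem_supported (s := i) (by simp) hL.1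
  rw [hLc, coeff_sub, coeff_X, coeff_C, if_neg (by simp [eq_comm])] at h0
  simp at h0

end IsRowOperation

theorem exists_isRowOperation_minimal (hα : IsAut α) (i : Fin n) :
    ∃ s L, IsRowOperation i L ∧ bind₁ α L ∈ supported k (Set.Iic s) ∧
      ∀ M, IsRowOperation i M → bind₁ α M ∉ supported k (Set.Iio s) := by
  have hX : IsRowOperation (k := k) i (X i) := ⟨by simp, (totalDegree_X i).le⟩
  obtain ⟨s₀, -, hs₀⟩ := exists_mem_vars_mem_supported_Iic (hX.vars_bind₁_nonempty hα)
  obtain ⟨s, ⟨L, hL, hLs⟩, hmin⟩ := WellFounded.has_min (wellFounded_lt (α := Fin n))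
    {s | ∃ L, IsRowOperation i L ∧ bind₁ α L ∈ supported k (Set.Iic s)} ⟨s₀, X i, hX, hs₀⟩
  refine ⟨s, L, hL, hLs, fun M hM hMs => ?_⟩
  obtain ⟨s', hs', hMs'⟩ := exists_mem_vars_mem_supported_Iic (hM.vars_bind₁_nonempty hα)
  exact hmin s' ⟨M, hM, hMs'⟩ (mem_supported.1 hMs hs')

/-- Gaussian elimination, the reduced rows being the `bind₁ α (L i)`. -/
theorem IsAffineAut.exists_rowReduction (hα : IsAffineAut α) :
    ∃ (L : PolyEnd k n) (π : Equiv.Perm (Fin n)), (∀ i, L i - X i ∈ supported k (Set.Iio i)) ∧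
      ∀ i, bind₁ α (L i) ∈ supported k (Set.Iic (π i)) := by
  choose s L hL hLs hmin using exists_isRowOperation_minimal hα.1
  have coeff_ne_zero (i : Fin n) {M} (hM : IsRowOperation i M)
      (hMs : bind₁ α M ∈ supported k (Set.Iic (s i))) :
      coeff (Finsupp.single (s i) 1) (bind₁ α M) ≠ 0 := fun h0 =>
    hmin i M hM
      (mem_supported_Iio_of_totalDegree_le_one (hM.totalDegree_bind₁_le_one hα) hMs h0)
  have ne_of_lt {i j : Fin n} (hij : i < j) : s i ≠ s j := by
    intro heq
    set c := coeff (Finsupp.single (s j) 1) (bind₁ α (L i)) with hc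
    set c' := coeff (Finsupp.single (s j) 1) (bind₁ α (L j)) with hc'
    have hc0 : c ≠ 0 := by
      rw [hc, ← heq]
      exact coeff_ne_zero i (hL i) (hLs i)
    refine coeff_ne_zero j ((hL j).sub_C_mul (hL i) hij (c' / c)) ?_ ?_
    · rw [map_sub, map_mul, bind₁_C_right]
      exact sub_mem (hLs j) (C_mul_mem_supported _ (heq ▸ hLs i))
    · rw [map_sub, map_mul, bind₁_C_right, coeff_sub, coeff_C_mul, ← hc, ← hc',
        div_mul_cancel₀ _ hc0, sub_self]
  have hs : Function.Injective s := .of_lt_imp_ne fun _ _ => ne_of_lt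
  exact ⟨L, Equiv.ofBijective s (Finite.injective_iff_bijective.1 hs), fun i => (hL i).1, hLs⟩

/-- The row operations that reduce the affine factor are triangular: after conjugation, they are
absorbed by the triangular factor. -/
theorem IsAffineTriangular.exists_conj {f : PolyEnd k n} (hf : IsAut f)
    (h : IsAffineTriangular f) : ∃ (φ ψ τ : PolyEnd k n) (π : Equiv.Perm (Fin n)),
      comp ψ φ = one k n ∧ comp φ ψ = one k n ∧ IsDeJonquieres τ ∧
      comp φ (comp f ψ) = fun i => τ (π i) := by
  obtain ⟨α, τ₀, hα, hτ₀, rfl⟩ := h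
  obtain ⟨L, π, hL, hLπ⟩ := hα.exists_rowReduction
  have hLJ : IsDeJonquieres L := fun i => ⟨1, one_ne_zero, _, hL i, by simp⟩
  obtain ⟨ψ, hLψ, hψL⟩ := hLJ.isAut
  have hψ := hLJ.isTriangular.of_comp_eq_one hLψ
  have hconj : IsAut (comp L (comp (comp α τ₀) ψ)) :=
    hLJ.isAut.comp (hf.comp ⟨L, hψL, hLψ⟩)
  have hassoc : comp L (comp (comp α τ₀) ψ) = comp (comp L α) (comp τ₀ ψ) := by
    simp only [comp_assoc]
  refine ⟨L, ψ, comp (perm k π.symm) (comp L (comp (comp α τ₀) ψ)), π, hψL, hLψ, ?_, ?_⟩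
  · refine IsTriangular.isDeJonquieres (fun j => ?_) ((perm_isAut _).comp hconj)
    rw [perm_comp, hassoc]
    have hj := hLπ (π.symm j)
    rw [π.apply_symm_apply] at hj
    refine bind₁_mem_supported (fun v hv => ?_) hj
    exact bind₁_mem_supported (fun u hu => supported_mono
      (Set.Iic_subset_Iic.2 (le_trans (Set.mem_Iic.1 hu) (Set.mem_Iic.1 hv))) (hψ u)) (hτ₀ v)
  · rw [perm_comp]
    funext i
    simp

end NormalForm

end PolyEnd

section Substitution

variable {R : Type*} [CommSemiring R] {σ σ' : Type*}

theorem bind₁_congr_of_mem_supported {S : Set σ} {g g' : σ → MvPolynomial σ' R}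
    (h : ∀ i ∈ S, g i = g' i) {p : MvPolynomial σ R} (hp : p ∈ supported R S) :
    bind₁ g p = bind₁ g' p := by
  refine AlgHom.adjoin_le_equalizer (bind₁ g) (bind₁ g') ?_ hp
  rintro _ ⟨j, hj, rfl⟩
  simpa using h j hj

theorem bind₁_eq_self_of_mem_supported {S : Set σ} {g : σ → MvPolynomial σ R}
    (h : ∀ i ∈ S, g i = X i) {p : MvPolynomial σ R} (hp : p ∈ supported R S) :
    bind₁ g p = p := by
  rw [bind₁_congr_of_mem_supported h hp, bind₁_X_left, AlgHom.id_apply]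

variable [DecidableEq σ]

theorem natDegree_polynomialIn_ne_zero {s : σ} {p : MvPolynomial σ R}
    (hp : ∃ d, coeff d p ≠ 0 ∧ d s ≠ 0) : (polynomialIn s p).natDegree ≠ 0 := by
  intro h0
  have hconst := eval_polynomialIn s p
  rw [Polynomial.eq_C_of_natDegree_eq_zero h0, Polynomial.eval_C] at hconst
  have hmem : p ∈ supported R {s}ᶜ := by
    rw [← hconst]
    exact coeff_polynomialIn_mem (by simp [Set.insert_eq]) 0
  obtain ⟨d, hd, hds⟩ := hp
  exact mem_supported_iff_coeff.1 hmem d hd s hds rfl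

theorem polynomialIn_bind₁_update (s : σ) (p q : MvPolynomial σ R) :
    polynomialIn s (bind₁ (Function.update X s p) q) =
      (polynomialIn s q).comp (polynomialIn s p) := by
  induction q using MvPolynomial.induction_on with
  | C a =>
    have hC : polynomialIn s (C a : MvPolynomial σ R) = Polynomial.C (C a) :=
      polynomialIn_eq_C (Set.notMem_empty s) (Subalgebra.algebraMap_mem _ a)
    rw [bind₁_C_right, hC, Polynomial.C_comp]
  | add q q' hq hq' => simp [hq, hq']
  | mul_X q i hq =>
    rw [map_mul, map_mul, map_mul, hq, Polynomial.mul_comp, bind₁_X_right]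
    congr 1
    by_cases h : i = s
    · simp [h, polynomialIn_X_self]
    · simp [h, polynomialIn]

end Substitution

namespace PolyEnd

variable {k : Type*} [Field k] {n : ℕ}

section Dominant

/-- Dominant endomorphisms of affine space: the comorphism is injective, that is, the components
are algebraically independent. -/
def IsDominant (f : PolyEnd k n) : Prop :=
  AlgebraicIndependent k f

theorem IsDominant.injective {f : PolyEnd k n} (hf : IsDominant f) :
    Function.Injective (bind₁ f) :=
  hf

theorem IsAut.isDominant {f : PolyEnd k n} (hf : IsAut f) : IsDominant f := by
  obtain ⟨g, h, -⟩ := hf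
  exact (leftInverse_bind₁ h).injective

theorem IsDominant.comp {f g : PolyEnd k n} (hf : IsDominant f) (hg : IsDominant g) :
    IsDominant (PolyEnd.comp f g) := by
  intro p q h
  change bind₁ (PolyEnd.comp f g) p = bind₁ (PolyEnd.comp f g) q at h
  rw [bind₁_comp, bind₁_comp] at h
  exact hf.injective (hg.injective h)

theorem IsDominant.iter {f : PolyEnd k n} (hf : IsDominant f) (r : ℕ) :
    IsDominant (iter f r) := by
  induction r with
  | zero => exact IsAut.isDominant ⟨one k n, one_comp _, one_comp _⟩
  | succ r ih => exact hf.comp ih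

theorem isDominant_update {s : Fin n} {p : MvPolynomial (Fin n) k}
    (hp : ∃ d, coeff d p ≠ 0 ∧ d s ≠ 0) : IsDominant (Function.update (one k n) s p) := by
  refine (injective_iff_map_eq_zero (bind₁ (Function.update (one k n) s p))).2 fun q hq => ?_
  have hcomp := polynomialIn_bind₁_update s p q
  rw [show bind₁ (Function.update X s p) q = 0 from hq, map_zero, eq_comm,
    Polynomial.comp_eq_zero_iff] at hcomp
  rcases hcomp with h | ⟨-, h⟩
  · rw [← eval_polynomialIn s q, h, Polynomial.eval_zero]
  · exact absurd (by rw [h, Polynomial.natDegree_C]) (natDegree_polynomialIn_ne_zero hp)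

theorem exists_isDominant_pair {s t : Fin n} (hst : s ≠ t) {p q : MvPolynomial (Fin n) k}
    (hp : p ∈ supported k {s}) (hps : ∃ d, coeff d p ≠ 0 ∧ d s ≠ 0)
    (hqt : ∃ d, coeff d q ≠ 0 ∧ d t ≠ 0) :
    ∃ G : PolyEnd k n, IsDominant G ∧ G s = p ∧ G t = q := by
  refine ⟨_, (isDominant_update hps).comp (isDominant_update hqt), ?_, ?_⟩
  · simp only [comp, Function.update_self]
    refine bind₁_eq_self_of_mem_supported (fun i hi => ?_) hp
    rw [Set.mem_singleton_iff.1 hi, Function.update_of_ne hst, one]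
  · simp [comp, Function.update_of_ne hst.symm, one]

theorem IsDominant.iter_ne_zero_of_eqOn {g G : PolyEnd k n} (hG : IsDominant G) {S : Set (Fin n)}
    (hg : Set.EqOn g G S) (hS : ∀ i ∈ S, g i ∈ supported k S) {s : Fin n}
    (hs : s ∈ S) (r : ℕ) : PolyEnd.iter g r s ≠ 0 := by
  have hiter : Set.EqOn (PolyEnd.iter g r) (PolyEnd.iter G r) S := by
    induction r with
    | zero => exact fun _ _ => rfl
    | succ r ih =>
      intro i hi
      change bind₁ (PolyEnd.iter g r) (g i) = bind₁ (PolyEnd.iter G r) (G i)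
      rw [bind₁_congr_of_mem_supported ih (hS i hi), hg hi]
  rw [hiter hs]
  exact AlgebraicIndependent.ne_zero (hG.iter r) s

end Dominant

section LowerBounds

/-- `d` is a monomial of `fᵢ` of the weight `t * wᵢ`, the maximal one allowed when `f` multiplies
the weights by at most `t`. -/
def IsTopMonomial (f : PolyEnd k n) (w : Fin n → ℝ) (t : ℝ) (i : Fin n) (d : Fin n →₀ ℕ) : Prop :=
  coeff d (f i) ≠ 0 ∧ Finsupp.weight w d = t * w i

variable {f : PolyEnd k n} {l : ℝ} {w : Fin n → ℝ} {t : ℝ}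

theorem coeff_weightedHomogeneousComponent_ne_zero {i : Fin n} {d : Fin n →₀ ℕ} :
    coeff d (weightedHomogeneousComponent w (t * w i) (f i)) ≠ 0 ↔ IsTopMonomial f w t i d := by
  classical
  rw [coeff_weightedHomogeneousComponent, ite_ne_right_iff, IsTopMonomial, and_comm]

theorem weightedHomogeneousComponent_mem_supported {i : Fin n} {S : Set (Fin n)}
    (h : ∀ d, IsTopMonomial f w t i d → ∀ v, d v ≠ 0 → v ∈ S) :
    weightedHomogeneousComponent w (t * w i) (f i) ∈ supported k S :=
  mem_supported_iff_coeff.2 fun d hd => h d (coeff_weightedHomogeneousComponent_ne_zero.1 hd)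

theorem exists_coeff_weightedHomogeneousComponent_ne_zero {i v : Fin n}
    (h : ∃ d, IsTopMonomial f w t i d ∧ d v ≠ 0) :
    ∃ d, coeff d (weightedHomogeneousComponent w (t * w i) (f i)) ≠ 0 ∧ d v ≠ 0 := by
  obtain ⟨d, hd, hv⟩ := h
  exact ⟨d, coeff_weightedHomogeneousComponent_ne_zero.2 hd, hv⟩

theorem HasDynamicalDegree.le_of_isDominant (h : f.HasDynamicalDegree l) (ht : 0 < t)
    (hw : ∀ i, 0 ≤ w i) (hf : ∀ i, f i ∈ restrictWeight k w (Set.Iic (t * w i))) {G : PolyEnd k n}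
    (hG : IsDominant G) {S : Set (Fin n)}
    (hg : ∀ i ∈ S, weightedHomogeneousComponent w (t * w i) (f i) = G i)
    (hS : ∀ i ∈ S, ∀ d, IsTopMonomial f w t i d → ∀ v, d v ≠ 0 → v ∈ S) {s : Fin n} (hs : s ∈ S)
    (hws : 0 < w s) : t ≤ l :=
  h.le_of_leadingPart ht hw
    (fun i => hasLeadingPart_weightedHomogeneousComponent (hf i)) hws fun r =>
    hG.iter_ne_zero_of_eqOn hg
      (fun i hi => weightedHomogeneousComponent_mem_supported (hS i hi)) hs r

theorem HasDynamicalDegree.le_of_single (h : f.HasDynamicalDegree l) (ht : 0 < t)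
    (hw : ∀ i, 0 ≤ w i) (hf : ∀ i, f i ∈ restrictWeight k w (Set.Iic (t * w i))) {s : Fin n}
    (hs : ∀ d, IsTopMonomial f w t s d → ∀ v, d v ≠ 0 → v = s)
    (hs' : ∃ d, IsTopMonomial f w t s d ∧ d s ≠ 0) (hws : 0 < w s) : t ≤ l := by
  refine h.le_of_isDominant (S := {s}) ht hw hf
    (isDominant_update (exists_coeff_weightedHomogeneousComponent_ne_zero hs')) ?_ ?_ rfl hws
  · rintro i rfl
    simp
  · rintro i rfl
    exact hs

theorem HasDynamicalDegree.le_of_skew (h : f.HasDynamicalDegree l) (ht : 0 < t)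
    (hw : ∀ i, 0 ≤ w i) (hf : ∀ i, f i ∈ restrictWeight k w (Set.Iic (t * w i))) {s u : Fin n}
    (hsu : s ≠ u) (hs : ∀ d, IsTopMonomial f w t s d → ∀ v, d v ≠ 0 → v = s)
    (hs' : ∃ d, IsTopMonomial f w t s d ∧ d s ≠ 0)
    (hu : ∀ d, IsTopMonomial f w t u d → ∀ v, d v ≠ 0 → v = s ∨ v = u)
    (hu' : ∃ d, IsTopMonomial f w t u d ∧ d u ≠ 0) (hwu : 0 < w u) : t ≤ l := by
  obtain ⟨G, hG, hGs, hGu⟩ := exists_isDominant_pair hsu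
    (weightedHomogeneousComponent_mem_supported hs)
    (exists_coeff_weightedHomogeneousComponent_ne_zero hs')
    (exists_coeff_weightedHomogeneousComponent_ne_zero hu')
  refine h.le_of_isDominant (S := {s, u}) ht hw hf hG ?_ ?_ (s := u) (by simp) hwu
  · rintro i (rfl | rfl)
    exacts [hGs.symm, hGu.symm]
  · rintro i (rfl | rfl)
    exacts [fun d hd v hv => Or.inl (hs d hd v hv), hu]

theorem HasDynamicalDegree.le_of_twisted (h : f.HasDynamicalDegree l) (ht : 0 < t)
    (hw : ∀ i, 0 ≤ w i) (hf : ∀ i, f i ∈ restrictWeight k w (Set.Iic (t * w i))) {s u : Fin n}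
    (hsu : s ≠ u) (hu : ∀ d, IsTopMonomial f w t u d → ∀ v, d v ≠ 0 → v = s)
    (hu' : ∃ d, IsTopMonomial f w t u d ∧ d s ≠ 0)
    (hs : ∀ d, IsTopMonomial f w t s d → ∀ v, d v ≠ 0 → v = s ∨ v = u)
    (hs' : ∃ d, IsTopMonomial f w t s d ∧ d u ≠ 0) (hws : 0 < w s) : t ≤ l := by
  obtain ⟨G, hG, hGs, hGu⟩ := exists_isDominant_pair hsu
    (weightedHomogeneousComponent_mem_supported hu)
    (exists_coeff_weightedHomogeneousComponent_ne_zero hu')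
    (exists_coeff_weightedHomogeneousComponent_ne_zero hs')
  refine h.le_of_isDominant (S := {s, u}) ht hw hf
    ((perm_isAut (Equiv.swap s u)).isDominant.comp hG) ?_ ?_ (s := s) (by simp) hws
  · rintro i (rfl | rfl)
    · simp [perm_comp, hGu]
    · simp [perm_comp, hGs]
  · rintro i (rfl | rfl)
    exacts [hs, fun d hd v hv => Or.inl (hu d hd v hv)]

end LowerBounds

section MonomialsOfTriangular

theorem exists_max_exponent {R σ : Type*} [CommSemiring R] {p : MvPolynomial σ R} (hp : p ≠ 0)
    (s : σ) : ∃ D, (∀ d, coeff d p ≠ 0 → d s ≤ D) ∧ ∃ d, coeff d p ≠ 0 ∧ d s = D := by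
  obtain ⟨d, hd, hmax⟩ := Finset.exists_max_image p.support (fun d => d s) (by simpa using hp)
  exact ⟨d s, fun d' hd' => hmax d' (mem_support_iff.2 hd'), d, mem_support_iff.1 hd, rfl⟩

theorem exponent_le_degree (f : PolyEnd k n) {i : Fin n} {d : Fin n →₀ ℕ}
    (hd : coeff d (f i) ≠ 0) (v : Fin n) : d v ≤ f.degree :=
  ((monomial_le_degreeOf v (mem_support_iff.2 hd)).trans (degreeOf_le_totalDegree _ v)).trans
    (totalDegree_le_degree f i)

variable {τ : PolyEnd k n}

theorem coeff_C_mul_X_add_cases {R σ : Type*} [CommSemiring R] {v : σ} {a : R}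
    {p : MvPolynomial σ R} {T : Set σ} (hp : p ∈ supported R T) {d : σ →₀ ℕ}
    (hd : coeff d (C a * X v + p) ≠ 0) : d = Finsupp.single v 1 ∨ ∀ x, x ∉ T → d x = 0 := by
  classical
  rw [coeff_add, coeff_C_mul, coeff_X] at hd
  by_cases hv : Finsupp.single v 1 = d
  · exact Or.inl hv.symm
  rw [if_neg hv, mul_zero, zero_add] at hd
  refine Or.inr fun x hx => ?_
  by_contra h0
  exact hx (mem_supported_iff_coeff.1 hp d hd x h0)

theorem coeff_single_C_mul_X_add {R σ : Type*} [CommSemiring R] {v : σ} {a : R}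
    {p : MvPolynomial σ R} {T : Set σ} (hv : v ∉ T) (hp : p ∈ supported R T) :
    coeff (Finsupp.single v 1) (C a * X v + p) = a := by
  classical
  rw [coeff_add, coeff_C_mul, coeff_X, if_pos rfl, coeff_single_eq_zero_of_mem_supported hv hp,
    mul_one, add_zero]

theorem IsDeJonquieres.coeff_cases (hτ : IsDeJonquieres τ) {i : Fin n} {d : Fin n →₀ ℕ}
    (hd : coeff d (τ i) ≠ 0) : d = Finsupp.single i 1 ∨ ∀ v, i ≤ v → d v = 0 := by
  obtain ⟨a, -, p, hp, h⟩ := hτ i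
  rw [h] at hd
  simpa using coeff_C_mul_X_add_cases hp hd

theorem IsDeJonquieres.coeff_single (hτ : IsDeJonquieres τ) (i : Fin n) :
    coeff (Finsupp.single i 1) (τ i) ≠ 0 := by
  obtain ⟨a, ha, p, hp, h⟩ := hτ i
  rwa [h, coeff_single_C_mul_X_add (by simp) hp]

theorem IsDeJonquieres.ne_zero (hτ : IsDeJonquieres τ) (i : Fin n) : τ i ≠ 0 :=
  ne_zero_iff.2 ⟨_, hτ.coeff_single i⟩

theorem sum_mul_pow_le_pow {N : ℕ} {d : Fin n → ℕ} (hd : ∀ v, d v ≤ N) {i : Fin n}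
    (hi : ∀ v, i ≤ v → d v = 0) : ∑ v, d v * (N + 1) ^ (v : ℕ) ≤ (N + 1) ^ (i : ℕ) :=
  calc ∑ v, d v * (N + 1) ^ (v : ℕ) = ∑ v ∈ Finset.Iio i, d v * (N + 1) ^ (v : ℕ) := by
        refine (Finset.sum_subset (Finset.subset_univ _) fun v _ hv => ?_).symm
        rw [hi v (by simpa using hv), zero_mul]
    _ ≤ ∑ v ∈ Finset.Iio i, N * (N + 1) ^ (v : ℕ) :=
        Finset.sum_le_sum fun v _ => Nat.mul_le_mul_right _ (hd v)
    _ = N * ∑ m ∈ Finset.range i, (N + 1) ^ m := by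
        rw [← Nat.Iio_eq_range, ← Fin.map_valEmbedding_Iio, Finset.sum_map, Finset.mul_sum]
        rfl
    _ ≤ (N + 1) ^ (i : ℕ) := by
        have := geom_sum_mul_add N (i : ℕ)
        rw [mul_comm]
        lia

theorem IsDeJonquieres.dynamicalDegree_le_one (hτ : IsDeJonquieres τ) {l : ℝ}
    (h : τ.HasDynamicalDegree l) : l ≤ 1 := by
  set w : Fin n → ℝ := fun i => ((τ.degree : ℝ) + 1) ^ (i : ℕ) with hw
  have hw0 (i : Fin n) : 0 < w i := by positivity
  refine h.le_of_weights zero_le_one fun t ht => ⟨w, hw0, fun i => mem_restrictWeight.2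
    fun d hd => ?_⟩
  have hle : Finsupp.weight w d ≤ w i := by
    rw [Finsupp.weight_eq_sum]
    rcases hτ.coeff_cases hd with rfl | h0
    · rw [Finset.sum_eq_single i] <;> simp +contextual [Finsupp.single_eq_of_ne]
    · simp only [nsmul_eq_mul, hw]
      exact_mod_cast sum_mul_pow_le_pow (exponent_le_degree τ hd) h0
  exact hle.trans (le_mul_of_one_le_left (hw0 i).le ht.le)

end MonomialsOfTriangular

section WeightsOnThreeSpace

variable {f : PolyEnd k 3} {a b c t : ℝ} (π : Equiv.Perm (Fin 3))

theorem eq_or_eq_or_eq (v : Fin 3) : v = π 0 ∨ v = π 1 ∨ v = π 2 := by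
  obtain ⟨j, rfl⟩ := π.surjective v
  fin_cases j <;> simp

theorem weight_vec_three (a b c : ℝ) (d : Fin 3 →₀ ℕ) :
    Finsupp.weight (![a, b, c] ∘ π.symm) d = d (π 0) * a + d (π 1) * b + d (π 2) * c := by
  rw [Finsupp.weight_eq_sum, ← Equiv.sum_comp π, Fin.sum_univ_three]
  simp

theorem mem_restrictWeight_vec_three
    (h0 : ∀ d, coeff d (f (π 0)) ≠ 0 → d (π 0) * a + d (π 1) * b + d (π 2) * c ≤ t * a)
    (h1 : ∀ d, coeff d (f (π 1)) ≠ 0 → d (π 0) * a + d (π 1) * b + d (π 2) * c ≤ t * b)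
    (h2 : ∀ d, coeff d (f (π 2)) ≠ 0 → d (π 0) * a + d (π 1) * b + d (π 2) * c ≤ t * c)
    (i : Fin 3) :
    f i ∈ restrictWeight k (![a, b, c] ∘ π.symm) (Set.Iic (t * (![a, b, c] ∘ π.symm) i)) := by
  refine mem_restrictWeight.2 fun d hd => ?_
  rw [Set.mem_Iic, weight_vec_three]
  rcases eq_or_eq_or_eq π i with rfl | rfl | rfl
  exacts [by simpa using h0 d hd, by simpa using h1 d hd, by simpa using h2 d hd]

theorem vec_three_pos (ha : 0 < a) (hb : 0 < b) (hc : 0 < c) (i : Fin 3) :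
    0 < (![a, b, c] ∘ π.symm) i := by
  rcases eq_or_eq_or_eq π i with rfl | rfl | rfl <;> simpa

theorem vec_three_nonneg (ha : 0 ≤ a) (hb : 0 ≤ b) (hc : 0 ≤ c) (i : Fin 3) :
    0 ≤ (![a, b, c] ∘ π.symm) i := by
  rcases eq_or_eq_or_eq π i with rfl | rfl | rfl <;> simpa

end WeightsOnThreeSpace

section Fibred

/-- Endomorphisms of affine 3-space of Hénon type over an affine endomorphism of the line: in the
coordinates `(x, y, z)` numbered by `π`, they are `(a x + a', b z + p(x, y), c y + q(x))`. Only the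
possible monomials are recorded. -/
structure IsFibredHenon (f : PolyEnd k 3) (π : Equiv.Perm (Fin 3)) : Prop where
  base : ∀ d, coeff d (f (π 0)) ≠ 0 → d (π 0) ≤ 1 ∧ d (π 1) = 0 ∧ d (π 2) = 0
  fst : ∀ d, coeff d (f (π 1)) ≠ 0 →
    (d (π 0) = 0 ∧ d (π 1) = 0 ∧ d (π 2) = 1) ∨ d (π 2) = 0
  snd : ∀ d, coeff d (f (π 2)) ≠ 0 →
    (d (π 0) = 0 ∧ d (π 1) = 1 ∧ d (π 2) = 0) ∨ (d (π 1) = 0 ∧ d (π 2) = 0)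

theorem exists_le_and_le_mul (N : ℝ) {c : ℝ} (hc : 0 < c) : ∃ M > 0, N ≤ M ∧ N ≤ c * M := by
  refine ⟨max 1 (max N (N / c)), by positivity, by simp, ?_⟩
  rw [← div_le_iff₀' hc]
  simp

variable {f : PolyEnd k 3} {π : Equiv.Perm (Fin 3)} {l : ℝ} {D : ℕ}

/-- The weights are `(1, t M, M)` with `M` large. -/
theorem IsFibredHenon.dynamicalDegree_le (hf : IsFibredHenon f π) (h : f.HasDynamicalDegree l)
    (hD : ∀ d, coeff d (f (π 1)) ≠ 0 → d (π 1) ≤ D) : l ≤ max (D : ℝ) 1 := by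
  refine h.le_of_weights (by positivity) fun t ht => ?_
  obtain ⟨htD, ht1⟩ : D < t ∧ 1 < t := max_lt_iff.1 ht
  have ht0 : 0 < t := zero_lt_one.trans ht1
  obtain ⟨M, hM0, hM1, hM2⟩ :=
    exists_le_and_le_mul (f.degree : ℝ) (mul_pos ht0 (sub_pos.2 htD))
  have hMt : M ≤ t * M := le_mul_of_one_le_left hM0.le ht1.le
  have exponent_le {i v : Fin 3} {d : Fin 3 →₀ ℕ} (hd : coeff d (f i) ≠ 0) :
      (d v : ℝ) ≤ f.degree := Nat.cast_le.2 (exponent_le_degree f hd v)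
  refine ⟨_, vec_three_pos π one_pos (mul_pos ht0 hM0) hM0,
    mem_restrictWeight_vec_three π (fun d hd => ?_) (fun d hd => ?_) fun d hd => ?_⟩
  · obtain ⟨dx, dy, dz⟩ := hf.base d hd
    have : (d (π 0) : ℝ) ≤ 1 := by exact_mod_cast dx
    simp only [dy, dz, Nat.cast_zero]
    linarith
  · rcases hf.fst d hd with ⟨dx, dy, dz⟩ | dz
    · simp only [dx, dy, dz, Nat.cast_zero, Nat.cast_one]
      linarith [mul_le_mul_of_nonneg_left hMt ht0.le]
    · have hdD : d (π 1) * (t * M) ≤ D * (t * M) :=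
        mul_le_mul_of_nonneg_right (Nat.cast_le.2 (hD d hd)) (mul_pos ht0 hM0).le
      simp only [dz, Nat.cast_zero]
      linarith [exponent_le hd (v := π 0)]
  · rcases hf.snd d hd with ⟨dx, dy, dz⟩ | ⟨dy, dz⟩
    · simp only [dx, dy, dz, Nat.cast_zero, Nat.cast_one]
      linarith
    · simp only [dy, dz, Nat.cast_zero]
      linarith [exponent_le hd (v := π 0)]

theorem IsFibredHenon.mem_restrictWeight (hf : IsFibredHenon f π)
    (hD : ∀ d, coeff d (f (π 1)) ≠ 0 → d (π 1) ≤ D) (hD1 : 1 ≤ D) (i : Fin 3) :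
    f i ∈ restrictWeight k (![0, (D : ℝ), 1] ∘ π.symm)
      (Set.Iic (D * (![0, (D : ℝ), 1] ∘ π.symm) i)) := by
  have hD1 : (1 : ℝ) ≤ D := Nat.one_le_cast.2 hD1
  refine mem_restrictWeight_vec_three π (fun d hd => ?_) (fun d hd => ?_) (fun d hd => ?_) i
  · obtain ⟨-, dy, dz⟩ := hf.base d hd
    simp [dy, dz]
  · rcases hf.fst d hd with ⟨dx, dy, dz⟩ | dz
    · simp only [dx, dy, dz, Nat.cast_zero, Nat.cast_one]
      nlinarith
    · have hdD : (d (π 1) : ℝ) * D ≤ D * D :=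
        mul_le_mul_of_nonneg_right (Nat.cast_le.2 (hD d hd)) (by positivity)
      simpa [dz] using hdD
  · rcases hf.snd d hd with ⟨-, dy, dz⟩ | ⟨dy, dz⟩ <;> simp [dy, dz]

theorem IsFibredHenon.le_dynamicalDegree (hf : IsFibredHenon f π) (h : f.HasDynamicalDegree l)
    (hbase : ∃ d, coeff d (f (π 0)) ≠ 0 ∧ d (π 0) ≠ 0)
    (hD : ∀ d, coeff d (f (π 1)) ≠ 0 → d (π 1) ≤ D)
    (hD' : ∃ d, coeff d (f (π 1)) ≠ 0 ∧ d (π 1) = D) (hD2 : 2 ≤ D) : (D : ℝ) ≤ l := by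
  have hD2' : (2 : ℝ) ≤ D := by exact_mod_cast hD2
  refine h.le_of_skew (s := π 0) (u := π 1) (by linarith)
    (vec_three_nonneg π le_rfl (by linarith) zero_le_one)
    (hf.mem_restrictWeight hD (by lia)) (by simp) (fun d hd v hv => ?_) ?_ (fun d hd v hv => ?_) ?_
    (by simpa using (by lia : 0 < D))
  · obtain ⟨-, dy, dz⟩ := hf.base d hd.1
    rcases eq_or_eq_or_eq π v with rfl | rfl | rfl
    exacts [rfl, (hv dy).elim, (hv dz).elim]
  · obtain ⟨d, hd, dx⟩ := hbase
    obtain ⟨-, dy, dz⟩ := hf.base d hd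
    exact ⟨d, ⟨hd, by simp [weight_vec_three, dy, dz]⟩, dx⟩
  · have hweight := hd.2
    rw [weight_vec_three] at hweight
    rcases hf.fst d hd.1 with ⟨dx, dy, dz⟩ | dz
    · simp only [dx, dy, dz, Function.comp_apply, Equiv.symm_apply_apply, Matrix.cons_val_one,
        Matrix.cons_val_zero, Nat.cast_zero, Nat.cast_one] at hweight
      nlinarith
    · rcases eq_or_eq_or_eq π v with rfl | rfl | rfl
      exacts [Or.inl rfl, Or.inr rfl, (hv dz).elim]
  · obtain ⟨d, hd, dy⟩ := hD'
    refine ⟨d, ⟨hd, ?_⟩, by lia⟩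
    rcases hf.fst d hd with ⟨-, dy', -⟩ | dz
    · lia
    · simp [weight_vec_three, dz, dy]

theorem IsFibredHenon.exists_eq_natCast (hf : IsFibredHenon f π) (h : f.HasDynamicalDegree l)
    (hl : 1 < l) (hbase : ∃ d, coeff d (f (π 0)) ≠ 0 ∧ d (π 0) ≠ 0) (hne : f (π 1) ≠ 0) :
    ∃ D : ℕ, l = D := by
  obtain ⟨D, hD, hD'⟩ := exists_max_exponent hne (π 1)
  have hlD : l ≤ D := (le_max_iff.1 (hf.dynamicalDegree_le h hD)).resolve_right (not_le.2 hl)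
  have hD2 : 2 ≤ D := by exact_mod_cast hl.trans_le hlD
  exact ⟨D, le_antisymm hlD (hf.le_dynamicalDegree h hbase hD hD' hD2)⟩

end Fibred

section Recurrence

/-- The positive root of `t² = i t + m`, the growth rate of the recurrence of order two with
nonnegative coefficients `i` and `m`. -/
noncomputable def posRoot (i m : ℝ) : ℝ := (i + √(i ^ 2 + 4 * m)) / 2

theorem posRoot_sq {i m : ℝ} (hm : 0 ≤ m) : posRoot i m ^ 2 = i * posRoot i m + m := by
  have := Real.sq_sqrt (show 0 ≤ i ^ 2 + 4 * m by positivity)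
  unfold posRoot
  linear_combination this / 4

theorem le_sq_of_posRoot_le {i m t : ℝ} (hi : 0 ≤ i) (hm : 0 ≤ m) (h : posRoot i m ≤ t) :
    i * t + m ≤ t ^ 2 := by
  have hroot := posRoot_sq (i := i) hm
  have hi_le : i ≤ posRoot i m := by
    have : i ≤ √(i ^ 2 + 4 * m) := Real.le_sqrt_of_sq_le (by linarith)
    unfold posRoot
    linarith
  nlinarith [mul_nonneg (sub_nonneg.2 h) (by linarith : 0 ≤ t + posRoot i m - i)]

/-- Endomorphisms `(b z + q(x, y), β y + p(x), ℓ(x, y))` of affine 3-space with `ℓ` affine and `p`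
of degree at most `e`, where `ℓ` involves `y` only if `e = 1`. Only the possible monomials are
recorded. The degrees of the iterates of the first component then obey a recurrence of order two,
each monomial `xⁱ yʲ` of `q` contributing the equation `t² = i t + j e`. -/
structure IsRecurrent (f : PolyEnd k 3) (e : ℕ) : Prop where
  one_le : 1 ≤ e
  fst : ∀ d, coeff d (f 0) ≠ 0 → (d 0 = 0 ∧ d 1 = 0 ∧ d 2 = 1) ∨ d 2 = 0
  snd : ∀ d, coeff d (f 1) ≠ 0 →
    (d 0 = 0 ∧ d 1 = 1 ∧ d 2 = 0) ∨ (d 0 ≤ e ∧ d 1 = 0 ∧ d 2 = 0)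
  thd : ∀ d, coeff d (f 2) ≠ 0 →
    (d 0 ≤ 1 ∧ d 1 = 0 ∧ d 2 = 0) ∨ (e = 1 ∧ d 0 = 0 ∧ d 1 ≤ 1 ∧ d 2 = 0)

namespace IsRecurrent

variable {f : PolyEnd k 3} {e : ℕ} {l t : ℝ} {d : Fin 3 →₀ ℕ}

theorem weight_eq (t : ℝ) (e : ℕ) (d : Fin 3 →₀ ℕ) :
    Finsupp.weight ![t, e, t] d = d 0 * t + d 1 * e + d 2 * t :=
  weight_vec_three (Equiv.refl _) t e t d

theorem mem_restrictWeight (hf : IsRecurrent f e) (ht : 1 < t)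
    (hmax : ∀ d, coeff d (f 0) ≠ 0 → d 2 = 0 → d 0 * t + d 1 * (e : ℝ) ≤ t ^ 2) (i : Fin 3) :
    f i ∈ restrictWeight k ![t, e, t] (Set.Iic (t * ![t, e, t] i)) := by
  have he : (1 : ℝ) ≤ e := Nat.one_le_cast.2 hf.one_le
  refine mem_restrictWeight_vec_three (Equiv.refl _) (fun d hd => ?_) (fun d hd => ?_)
    (fun d hd => ?_) i <;> simp only [Equiv.refl_apply] at hd ⊢
  · rcases hf.fst d hd with ⟨dx, dy, dz⟩ | dz
    · simp only [dx, dy, dz, Nat.cast_zero, Nat.cast_one]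
      nlinarith
    · have := hmax d hd dz
      simp only [dz, Nat.cast_zero]
      linarith
  · rcases hf.snd d hd with ⟨dx, dy, dz⟩ | ⟨dx, dy, dz⟩
    · simp only [dx, dy, dz, Nat.cast_zero, Nat.cast_one]
      nlinarith
    · have : (d 0 : ℝ) ≤ e := Nat.cast_le.2 dx
      simp only [dy, dz, Nat.cast_zero]
      nlinarith
  · rcases hf.thd d hd with ⟨dx, dy, dz⟩ | ⟨rfl, dx, dy, dz⟩
    · have : (d 0 : ℝ) ≤ 1 := Nat.cast_le_one.2 dx
      simp only [dy, dz, Nat.cast_zero]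
      nlinarith
    · have : (d 1 : ℝ) ≤ 1 := Nat.cast_le_one.2 dy
      simp only [dx, dz, Nat.cast_zero, Nat.cast_one]
      nlinarith

theorem dynamicalDegree_le (hf : IsRecurrent f e) (h : f.HasDynamicalDegree l) {θ : ℝ}
    (hθ : 1 ≤ θ) (hmax : ∀ d, coeff d (f 0) ≠ 0 → d 2 = 0 → posRoot (d 0) (d 1 * e) ≤ θ) :
    l ≤ θ := by
  have he : (1 : ℝ) ≤ e := Nat.one_le_cast.2 hf.one_le
  refine h.le_of_weights (by linarith) fun t ht => ⟨![t, e, t], ?_,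
    hf.mem_restrictWeight (by linarith) fun d hd dz => ?_⟩
  · exact vec_three_pos (Equiv.refl _) (by linarith) (by linarith) (by linarith)
  · exact le_sq_of_posRoot_le (Nat.cast_nonneg _) (by positivity) ((hmax d hd dz).trans ht.le)

theorem exists_max_posRoot (hf : IsRecurrent f e) (h : f.HasDynamicalDegree l) (hl : 1 < l) :
    ∃ d₀, coeff d₀ (f 0) ≠ 0 ∧ d₀ 2 = 0 ∧ 1 < posRoot (d₀ 0) (d₀ 1 * e) ∧
      ∀ d, coeff d (f 0) ≠ 0 → d 2 = 0 → posRoot (d 0) (d 1 * e) ≤ posRoot (d₀ 0) (d₀ 1 * e) := by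
  obtain ⟨d₁, hd₁, hd₁z, hd₁1⟩ :
      ∃ d, coeff d (f 0) ≠ 0 ∧ d 2 = 0 ∧ 1 < posRoot (d 0) (d 1 * e) := by
    by_contra! hle
    exact hl.not_ge (hf.dynamicalDegree_le h le_rfl hle)
  obtain ⟨d₀, hd₀, hmax⟩ := Finset.exists_max_image {d ∈ (f 0).support | d 2 = 0}
    (fun d => posRoot (d 0) (d 1 * e)) ⟨d₁, by simp [hd₁, hd₁z]⟩
  simp only [Finset.mem_filter, mem_support_iff, and_imp] at hd₀ hmax
  exact ⟨d₀, hd₀.1, hd₀.2, hd₁1.trans_le (hmax d₁ hd₁ hd₁z), hmax⟩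

theorem isTopMonomial_fst (hf : IsRecurrent f e) (ht : 1 < t)
    (hd : IsTopMonomial f ![t, e, t] t 0 d) : d 2 = 0 := by
  rcases hf.fst d hd.1 with ⟨dx, dy, dz⟩ | dz
  · have hweight := hd.2
    simp only [weight_eq, dx, dy, dz, Matrix.cons_val_zero, Nat.cast_zero, Nat.cast_one]
      at hweight
    nlinarith
  · exact dz

theorem isTopMonomial_snd (hf : IsRecurrent f e) (ht : 1 < t)
    (hd : IsTopMonomial f ![t, e, t] t 1 d) : d 1 = 0 ∧ d 2 = 0 := by
  have he : (1 : ℝ) ≤ e := Nat.one_le_cast.2 hf.one_le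
  rcases hf.snd d hd.1 with ⟨dx, dy, dz⟩ | ⟨-, dy, dz⟩
  · have hweight := hd.2
    simp only [weight_eq, dx, dy, dz, Matrix.cons_val_one, Matrix.cons_val_zero, Nat.cast_zero,
      Nat.cast_one] at hweight
    nlinarith
  · exact ⟨dy, dz⟩

theorem exists_isTopMonomial_snd (hf : IsRecurrent f e)
    (he : ∃ d, coeff d (f 1) ≠ 0 ∧ d 0 = e) (t : ℝ) :
    ∃ d, IsTopMonomial f ![t, e, t] t 1 d ∧ d 0 ≠ 0 := by
  obtain ⟨d, hd, hde⟩ := he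
  have := hf.one_le
  refine ⟨d, ⟨hd, ?_⟩, by lia⟩
  rcases hf.snd d hd with ⟨dx, -, -⟩ | ⟨-, dy, dz⟩
  · lia
  · simp [weight_eq, dy, dz, hde, mul_comm]

theorem le_dynamicalDegree (hf : IsRecurrent f e) (h : f.HasDynamicalDegree l)
    (he : ∃ d, coeff d (f 1) ≠ 0 ∧ d 0 = e) (ht : 1 < t)
    (hmax : ∀ d, coeff d (f 0) ≠ 0 → d 2 = 0 → d 0 * t + d 1 * (e : ℝ) ≤ t ^ 2)
    (hd : coeff d (f 0) ≠ 0) (hdz : d 2 = 0) (hdt : t ^ 2 = d 0 * t + d 1 * e) : t ≤ l := by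
  have ht0 : 0 < t := by linarith
  have hnonneg : ∀ i, 0 ≤ ![t, (e : ℝ), t] i :=
    vec_three_nonneg (Equiv.refl _) ht0.le (Nat.cast_nonneg e) ht0.le
  have hmem := hf.mem_restrictWeight ht hmax
  have htop : IsTopMonomial f ![t, e, t] t 0 d := ⟨hd, by simp [weight_eq, hdz, ← hdt, sq]⟩
  by_cases hy : ∃ d, IsTopMonomial f ![t, e, t] t 0 d ∧ d 1 ≠ 0
  · refine h.le_of_twisted ht0 hnonneg hmem (s := 0) (u := 1) (by decide)
      (fun d hd v hv => ?_) (hf.exists_isTopMonomial_snd he t) (fun d hd v hv => ?_) hy ht0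
    · obtain ⟨dy, dz⟩ := hf.isTopMonomial_snd ht hd
      rcases eq_or_eq_or_eq (Equiv.refl _) v with rfl | rfl | rfl
      exacts [rfl, (hv dy).elim, (hv dz).elim]
    · have dz := hf.isTopMonomial_fst ht hd
      rcases eq_or_eq_or_eq (Equiv.refl _) v with rfl | rfl | rfl
      exacts [Or.inl rfl, Or.inr rfl, (hv dz).elim]
  · push Not at hy
    refine h.le_of_single ht0 hnonneg hmem (s := 0) (fun d hd v hv => ?_) ⟨d, htop, fun dx => ?_⟩
      ht0
    · have dy := hy d hd
      have dz := hf.isTopMonomial_fst ht hd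
      rcases eq_or_eq_or_eq (Equiv.refl _) v with rfl | rfl | rfl
      exacts [rfl, (hv dy).elim, (hv dz).elim]
    · rw [dx, hy d htop, Nat.cast_zero, zero_mul, zero_mul, add_zero] at hdt
      exact ht0.ne' (pow_eq_zero_iff two_ne_zero |>.1 hdt)

theorem exists_sq_eq (hf : IsRecurrent f e) (h : f.HasDynamicalDegree l) (hl : 1 < l)
    (he : ∃ d, coeff d (f 1) ≠ 0 ∧ d 0 = e) : ∃ i j : ℕ, l ^ 2 = i * l + j := by
  obtain ⟨d₀, hd₀, hd₀z, hθ, hmax⟩ := hf.exists_max_posRoot h hl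
  have hsq := posRoot_sq (i := d₀ 0) (m := d₀ 1 * e) (by positivity)
  have hlθ : l = posRoot (d₀ 0) (d₀ 1 * e) := by
    refine le_antisymm (hf.dynamicalDegree_le h hθ.le hmax)
      (hf.le_dynamicalDegree h he hθ (fun d hd dz => ?_) hd₀ hd₀z hsq)
    exact le_sq_of_posRoot_le (Nat.cast_nonneg _) (by positivity) (hmax d hd dz)
  exact ⟨d₀ 0, d₀ 1 * e, by rw [hlθ, Nat.cast_mul, hsq]⟩

end IsRecurrent

end Recurrence

theorem weight_eq_of_two {s u : Fin n} (hsu : s ≠ u) (w : Fin n → ℝ) {d : Fin n →₀ ℕ}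
    (hd : ∀ v, v ≠ s → v ≠ u → d v = 0) : Finsupp.weight w d = d s * w s + d u * w u := by
  rw [Finsupp.weight_eq_sum, Finset.sum_eq_add s u hsu]
  · simp
  · rintro c - ⟨hcs, hcu⟩
    simp [hd c hcs hcu]
  · simp
  · simp

section Henon

/-- Endomorphisms that extend an endomorphism of Hénon type of the plane with coordinates
`(x, y) = (xₛ, xᵤ)`: they are `(a y + p(x), b x + c)` on that plane, and `aᵥ xᵥ + qᵥ(x, y)` on each
further coordinate. Only the possible monomials are recorded. -/
structure IsHenonExtension (f : PolyEnd k n) (s u : Fin n) : Prop where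
  ne : s ≠ u
  fst : ∀ d, coeff d (f s) ≠ 0 → d = Finsupp.single u 1 ∨ ∀ v, v ≠ s → d v = 0
  snd : ∀ d, coeff d (f u) ≠ 0 → d = Finsupp.single s 1 ∨ d = 0
  other : ∀ v, v ≠ s → v ≠ u → ∀ d, coeff d (f v) ≠ 0 →
    d = Finsupp.single v 1 ∨ ∀ x, x ≠ s → x ≠ u → d x = 0

/-- Weights adapted to `IsHenonExtension f s u`: the coordinates `xₛ` and `xᵤ` have weights `t` and
`1`, the others a weight so large that the polynomials in `xₛ` and `xᵤ` occurring in `f` do not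
exceed it. -/
noncomputable def henonWeight (f : PolyEnd k n) (s u : Fin n) (t : ℝ) (i : Fin n) : ℝ :=
  if i = s then t else if i = u then 1 else f.degree * (t + 1) + 1

variable {f : PolyEnd k n} {s u : Fin n} {l t : ℝ} {D : ℕ}

theorem henonWeight_fst (f : PolyEnd k n) (s u : Fin n) (t : ℝ) : henonWeight f s u t s = t :=
  if_pos rfl

theorem henonWeight_snd (f : PolyEnd k n) (hsu : s ≠ u) (t : ℝ) : henonWeight f s u t u = 1 := by
  simp [henonWeight, hsu.symm]

theorem henonWeight_pos (f : PolyEnd k n) (s u : Fin n) (ht : 0 < t) (i : Fin n) :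
    0 < henonWeight f s u t i := by
  unfold henonWeight
  split_ifs <;> positivity

namespace IsHenonExtension

theorem weight_eq (hf : IsHenonExtension f s u) {d : Fin n →₀ ℕ}
    (hd : ∀ v, v ≠ s → v ≠ u → d v = 0) :
    Finsupp.weight (henonWeight f s u t) d = d s * t + d u := by
  rw [weight_eq_of_two hf.ne _ hd, henonWeight_fst, henonWeight_snd f hf.ne, mul_one]

theorem weight_eq_fst (hf : IsHenonExtension f s u) {d : Fin n →₀ ℕ} (hd : ∀ v, v ≠ s → d v = 0) :
    Finsupp.weight (henonWeight f s u t) d = d s * t := by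
  rw [hf.weight_eq fun v hv _ => hd v hv, hd u hf.ne.symm, Nat.cast_zero, add_zero]

theorem weight_le_other (hf : IsHenonExtension f s u) (ht : 1 < t) {v : Fin n} (hvs : v ≠ s)
    (hvu : v ≠ u) {d : Fin n →₀ ℕ} (hd : coeff d (f v) ≠ 0) :
    Finsupp.weight (henonWeight f s u t) d ≤ henonWeight f s u t v := by
  rcases hf.other v hvs hvu d hd with rfl | hd0
  · simp [Finsupp.weight_single]
  have hs : (d s : ℝ) ≤ f.degree := Nat.cast_le.2 (exponent_le_degree f hd s)
  have hu : (d u : ℝ) ≤ f.degree := Nat.cast_le.2 (exponent_le_degree f hd u)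
  rw [hf.weight_eq hd0, henonWeight, if_neg hvs, if_neg hvu]
  nlinarith

theorem mem_restrictWeight (hf : IsHenonExtension f s u)
    (hD : ∀ d, coeff d (f s) ≠ 0 → d s ≤ D) (ht : 1 < t) (htD : D ≤ t) (i : Fin n) :
    f i ∈ restrictWeight k (henonWeight f s u t) (Set.Iic (t * henonWeight f s u t i)) := by
  refine AffineDyn.mem_restrictWeight.2 fun d hd => ?_
  rw [Set.mem_Iic]
  by_cases his : i = s
  · subst his
    rw [henonWeight_fst]
    rcases hf.fst d hd with rfl | hd0
    · rw [Finsupp.weight_single, henonWeight_snd f hf.ne, one_smul]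
      nlinarith
    · rw [hf.weight_eq_fst hd0]
      exact mul_le_mul_of_nonneg_right ((Nat.cast_le.2 (hD d hd)).trans htD) (by linarith)
  by_cases hiu : i = u
  · subst hiu
    rw [henonWeight_snd f hf.ne]
    rcases hf.snd d hd with rfl | rfl
    · simp [Finsupp.weight_single, henonWeight_fst]
    · rw [map_zero]
      linarith
  · exact (hf.weight_le_other ht his hiu hd).trans
      (le_mul_of_one_le_left (henonWeight_pos f s u (by linarith) i).le ht.le)

theorem dynamicalDegree_le (hf : IsHenonExtension f s u) (h : f.HasDynamicalDegree l)
    (hD : ∀ d, coeff d (f s) ≠ 0 → d s ≤ D) : l ≤ max (D : ℝ) 1 := by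
  refine h.le_of_weights (by positivity) fun t ht => ?_
  obtain ⟨htD, ht1⟩ : D < t ∧ 1 < t := max_lt_iff.1 ht
  exact ⟨_, henonWeight_pos f s u (by linarith), hf.mem_restrictWeight hD ht1 htD.le⟩

theorem le_dynamicalDegree (hf : IsHenonExtension f s u) (h : f.HasDynamicalDegree l)
    (hD : ∀ d, coeff d (f s) ≠ 0 → d s ≤ D) (hD' : ∃ d, coeff d (f s) ≠ 0 ∧ d s = D)
    (hD2 : 2 ≤ D) : (D : ℝ) ≤ l := by
  have hD2' : (2 : ℝ) ≤ D := by exact_mod_cast hD2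
  refine h.le_of_single (s := s) (by linarith)
    (fun i => (henonWeight_pos f s u (by linarith) i).le)
    (hf.mem_restrictWeight hD (by linarith) le_rfl) (fun d hd v hv => ?_) ?_
    (henonWeight_pos f s u (by linarith) s)
  · rcases hf.fst d hd.1 with rfl | hd0
    · have hweight := hd.2
      simp only [Finsupp.weight_single, henonWeight_fst, henonWeight_snd f hf.ne,
        one_smul] at hweight
      nlinarith
    · by_contra hvs
      exact hv (hd0 v hvs)
  · obtain ⟨d, hd, hdD⟩ := hD'
    refine ⟨d, ⟨hd, ?_⟩, by lia⟩
    rcases hf.fst d hd with rfl | hd0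
    · rw [Finsupp.single_eq_of_ne hf.ne] at hdD
      lia
    · simp only [hf.weight_eq_fst hd0, henonWeight_fst, hdD]

theorem exists_eq_natCast (hf : IsHenonExtension f s u) (h : f.HasDynamicalDegree l) (hl : 1 < l)
    (hne : f s ≠ 0) : ∃ D : ℕ, l = D := by
  obtain ⟨D, hD, hD'⟩ := exists_max_exponent hne s
  have hlD : l ≤ D := (le_max_iff.1 (hf.dynamicalDegree_le h hD)).resolve_right (not_le.2 hl)
  have hD2 : 2 ≤ D := by exact_mod_cast hl.trans_le hlD
  exact ⟨D, le_antisymm hlD (hf.le_dynamicalDegree h hD hD' hD2)⟩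

end IsHenonExtension

end Henon

section LowDimension

variable {l : ℝ}

theorem HasDynamicalDegree.exists_normalForm {f : PolyEnd k n} (h : f.HasDynamicalDegree l)
    (hf : IsAut f) (hf' : IsAffineTriangular f) :
    ∃ (τ : PolyEnd k n) (π : Equiv.Perm (Fin n)), IsDeJonquieres τ ∧
      HasDynamicalDegree (fun i => τ (π i)) l := by
  obtain ⟨φ, ψ, τ, π, hψφ, hφψ, hτ, hπ⟩ := hf'.exists_conj hf
  exact ⟨τ, π, hτ, hπ ▸ h.conj hψφ hφψ⟩

theorem dynamicalDegree_le_one_of_dim_one {f : PolyEnd k 1} (h : f.HasDynamicalDegree l)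
    (hf : IsAut f) (hf' : IsAffineTriangular f) : l ≤ 1 := by
  obtain ⟨τ, π, hτ, h'⟩ := h.exists_normalForm hf hf'
  rw [Subsingleton.elim π 1] at h'
  exact hτ.dynamicalDegree_le_one h'

theorem IsDeJonquieres.isHenonExtension_swap {m : ℕ} (hm : m ≤ 1) {τ : PolyEnd k (m + 2)}
    (hτ : IsDeJonquieres τ) : IsHenonExtension (fun i => τ (Equiv.swap 0 1 i)) 0 1 where
  ne := by simp
  fst d hd := by
    simp only [Equiv.swap_apply_left] at hd
    exact (hτ.coeff_cases hd).imp_right fun hd v hv => hd v (Fin.one_le_of_ne_zero hv)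
  snd d hd := by
    simp only [Equiv.swap_apply_right] at hd
    exact (hτ.coeff_cases hd).imp_right fun hd => Finsupp.ext fun v => hd v (Fin.zero_le v)
  other v hv0 hv1 d hd := by
    simp only [Equiv.swap_apply_of_ne_of_ne hv0 hv1] at hd
    refine (hτ.coeff_cases hd).imp_right fun hd x hx0 hx1 => hd x ?_
    simp only [ne_eq, Fin.ext_iff, Fin.val_zero, Fin.val_one] at hv0 hx0 hx1
    lia

theorem exists_eq_natCast_of_swap {m : ℕ} (hm : m ≤ 1) {τ : PolyEnd k (m + 2)}
    (hτ : IsDeJonquieres τ) (h : HasDynamicalDegree (fun i => τ (Equiv.swap 0 1 i)) l)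
    (hl : 1 < l) : ∃ D : ℕ, l = D :=
  (hτ.isHenonExtension_swap hm).exists_eq_natCast h hl (hτ.ne_zero _)

theorem dynamicalDegree_of_dim_two {f : PolyEnd k 2} (h : f.HasDynamicalDegree l)
    (hf : IsAut f) (hf' : IsAffineTriangular f) (hl : 1 < l) : ∃ D : ℕ, l = D := by
  obtain ⟨τ, π, hτ, h'⟩ := h.exists_normalForm hf hf'
  have hπ : ∀ π : Equiv.Perm (Fin 2), π = 1 ∨ π = Equiv.swap 0 1 := by decide
  rcases hπ π with rfl | rfl
  · exact absurd (hτ.dynamicalDegree_le_one h') (not_le.2 hl)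
  · exact exists_eq_natCast_of_swap zero_le_one hτ h' hl

end LowDimension

end PolyEnd

section LinearCoordinate

variable {R σ : Type*} [Field R] {s t : σ} {a : R} {f : σ → MvPolynomial σ R}
  {p q : MvPolynomial σ R}

theorem exists_mem_supported_bind₁_eq (ha : a ≠ 0) (hp : p ∈ supported R ∅)
    (hf : f t = C a * X s + p) (hq : q ∈ supported R {s}) :
    ∃ m ∈ supported R {t}, bind₁ f m = q := by
  refine ⟨bind₁ (fun _ => C a⁻¹ * (X t - p)) q, ?_, ?_⟩
  · refine bind₁_mem_supported (S := {s}) (fun _ _ => C_mul_mem_supported _ (sub_mem ?_ ?_)) hq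
    · exact X_mem_supported.2 rfl
    · exact supported_mono (Set.empty_subset _) hp
  · have hpf : bind₁ f p = p := bind₁_eq_self_of_mem_supported (by simp) hp
    have ha' : (C a⁻¹ * C a : MvPolynomial σ R) = 1 := by
      rw [← C_mul, inv_mul_cancel₀ ha, C_1]
    rw [bind₁_bind₁]
    refine bind₁_eq_self_of_mem_supported (S := {s}) (fun i hi => ?_) hq
    rw [Set.mem_singleton_iff.1 hi, map_mul, map_sub, bind₁_C_right, bind₁_X_right, hf, hpf]
    linear_combination X s * ha'

end LinearCoordinate

namespace PolyEnd

variable {k : Type*} [Field k] {l : ℝ}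

section ThreeSpace

variable {τ f : PolyEnd k 3}

theorem comp_eq_one_fin_three {f g : PolyEnd k 3} (h0 : bind₁ g (f 0) = X 0)
    (h1 : bind₁ g (f 1) = X 1) (h2 : bind₁ g (f 2) = X 2) : comp f g = one k 3 := by
  funext i
  fin_cases i
  exacts [h0, h1, h2]

theorem IsDeJonquieres.exists_eq_fin_three (hτ : IsDeJonquieres τ) :
    ∃ a b c : k, a ≠ 0 ∧ b ≠ 0 ∧ c ≠ 0 ∧
      ∃ p ∈ supported k ∅, ∃ q ∈ supported k {0}, ∃ r ∈ supported k {0, 1},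
        τ 0 = C a * X 0 + p ∧ τ 1 = C b * X 1 + q ∧ τ 2 = C c * X 2 + r := by
  obtain ⟨a, ha, p, hp, h0⟩ := hτ 0
  obtain ⟨b, hb, q, hq, h1⟩ := hτ 1
  obtain ⟨c, hc, r, hr, h2⟩ := hτ 2
  have hIio0 : Set.Iio (0 : Fin 3) = ∅ := by ext i; simp
  have hIio1 : Set.Iio (1 : Fin 3) = {0} := by ext i; fin_cases i <;> simp
  have hIio2 : Set.Iio (2 : Fin 3) = {0, 1} := by ext i; fin_cases i <;> simp
  exact ⟨a, b, c, ha, hb, hc, p, hIio0 ▸ hp, q, hIio1 ▸ hq, r, hIio2 ▸ hr, h0, h1, h2⟩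

theorem HasDynamicalDegree.exists_of_shift (h : f.HasDynamicalDegree l) (hl : 1 < l) {a b c : k}
    (ha : a ≠ 0) {q p r : MvPolynomial (Fin 3) k} (hq : q ∈ supported k {0, 1})
    (hp : p ∈ supported k ∅) (hr : r ∈ supported k ∅) (h0 : f 0 = C b * X 2 + q)
    (h1 : f 1 = C a * X 0 + p) (h2 : f 2 = C c * X 1 + r) : ∃ i j : ℕ, l ^ 2 = i * l + j := by
  have hf : IsRecurrent f 1 := by
    refine ⟨le_rfl, fun d hd => ?_, fun d hd => ?_, fun d hd => ?_⟩
    · rw [h0] at hd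
      rcases coeff_C_mul_X_add_cases hq hd with rfl | hd
      · simp
      · exact Or.inr (hd 2 (by simp))
    · rw [h1] at hd
      rcases coeff_C_mul_X_add_cases hp hd with rfl | hd
      · simp
      · simp [hd]
    · rw [h2] at hd
      rcases coeff_C_mul_X_add_cases hr hd with rfl | hd
      · simp
      · simp [hd]
  refine hf.exists_sq_eq h hl ⟨Finsupp.single 0 1, ?_, by simp⟩
  rwa [h1, coeff_single_C_mul_X_add (by simp) hp]

/-- The coordinate `z` of `(c z + r(x, y), a x + p, b y + q(x))` is corrected by the polynomial
`m(y)` with `m(a x + p) = q(x)`. -/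
theorem HasDynamicalDegree.exists_of_cycle (hτ : IsDeJonquieres τ) (h : f.HasDynamicalDegree l)
    (hl : 1 < l) (h0 : f 0 = τ 2) (h1 : f 1 = τ 0) (h2 : f 2 = τ 1) :
    ∃ i j : ℕ, l ^ 2 = i * l + j := by
  obtain ⟨a, b, c, ha, -, -, p, hp, q, hq, r, hr, hτ0, hτ1, hτ2⟩ := hτ.exists_eq_fin_three
  rw [hτ2] at h0
  rw [hτ0] at h1
  rw [hτ1] at h2
  obtain ⟨m, hm, hfm⟩ := exists_mem_supported_bind₁_eq ha hp h1 hq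
  let φ : PolyEnd k 3 := ![X 0, X 1, X 2 - m]
  let ψ : PolyEnd k 3 := ![X 0, X 1, X 2 + m]
  have hψ0 : ψ 0 = X 0 := rfl
  have hψ1 : ψ 1 = X 1 := rfl
  have hψ2 : ψ 2 = X 2 + m := rfl
  have hφm : bind₁ φ m = m := bind₁_eq_self_of_mem_supported (by simp [φ]) hm
  have hψm : bind₁ ψ m = m := bind₁_eq_self_of_mem_supported (by simp [hψ1]) hm
  have hψp : bind₁ ψ p = p := bind₁_eq_self_of_mem_supported (by simp) hp
  have hψr : bind₁ ψ r = r := bind₁_eq_self_of_mem_supported (by simp [hψ0, hψ1]) hr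
  have hψφ : comp ψ φ = one k 3 :=
    comp_eq_one_fin_three (bind₁_X_right _ _) (bind₁_X_right _ _) <| by
      rw [hψ2, map_add, bind₁_X_right, hφm]
      exact sub_add_cancel _ _
  have hφψ : comp φ ψ = one k 3 :=
    comp_eq_one_fin_three (bind₁_X_right _ _) (bind₁_X_right _ _) <| by
      change bind₁ ψ (X 2 - m) = X 2
      rw [map_sub, bind₁_X_right, hψm, hψ2, add_sub_cancel_right]
  refine (h.conj hψφ hφψ).exists_of_shift hl (q := C c * m + r) (r := 0) (b := c) (c := b) ha
    (add_mem (C_mul_mem_supported _ (supported_mono (by simp) hm)) hr) hp (zero_mem _) ?_ ?_ ?_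
  · change bind₁ (comp f ψ) (X 0) = _
    rw [bind₁_X_right, comp, h0, map_add, map_mul, bind₁_C_right, bind₁_X_right, hψr, hψ2]
    ring
  · change bind₁ (comp f ψ) (X 1) = _
    rw [bind₁_X_right, comp, h1, map_add, map_mul, bind₁_C_right, bind₁_X_right, hψp, hψ0]
  · change bind₁ (comp f ψ) (X 2 - m) = _
    rw [bind₁_comp, map_sub, map_sub, hfm, bind₁_X_right, h2, map_add, map_mul, bind₁_C_right,
      bind₁_X_right, hψ1]
    ring

theorem exists_inverse_of_swap_shear {b : k} (hb : b ≠ 0) {q : MvPolynomial (Fin 3) k}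
    (hq : q ∈ supported k {0}) : ∃ ψ : PolyEnd k 3,
      comp ![C b * X 1 + q, X 0, X 2] ψ = one k 3 ∧ comp ψ ![C b * X 1 + q, X 0, X 2] = one k 3 ∧
      ψ 0 = X 1 ∧ ψ 1 ∈ supported k {0, 1} ∧ ψ 2 = X 2 := by
  have hCb : (C b⁻¹ * C b : MvPolynomial (Fin 3) k) = 1 := by
    rw [← C_mul, inv_mul_cancel₀ hb, C_1]
  obtain ⟨q', hq'⟩ : ∃ q' : MvPolynomial (Fin 3) k, q' = bind₁ (fun _ => X 1) q := ⟨_, rfl⟩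
  let φ : PolyEnd k 3 := ![C b * X 1 + q, X 0, X 2]
  let ψ : PolyEnd k 3 := ![X 1, C b⁻¹ * (X 0 - q'), X 2]
  have hψq : bind₁ ψ q = q' := by
    rw [hq']
    exact bind₁_congr_of_mem_supported (S := {0}) (by simp [ψ]) hq
  have hφq' : bind₁ φ q' = q := by
    rw [hq', bind₁_bind₁]
    exact bind₁_eq_self_of_mem_supported (S := {0}) (by simp [φ]) hq
  have hq'_mem : q' ∈ supported k {0, 1} :=
    hq' ▸ bind₁_mem_supported (S := {0}) (fun _ _ => X_mem_supported.2 (by simp)) hq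
  have hφψ : comp φ ψ = one k 3 := by
    refine comp_eq_one_fin_three ?_ (bind₁_X_right _ _) (bind₁_X_right _ _)
    change bind₁ ψ (C b * X 1 + q) = X 0
    rw [map_add, map_mul, bind₁_C_right, bind₁_X_right, hψq]
    change C b * (C b⁻¹ * (X 0 - q')) + q' = X 0
    linear_combination (X 0 - q') * hCb
  have hψφ : comp ψ φ = one k 3 := by
    refine comp_eq_one_fin_three (bind₁_X_right _ _) ?_ (bind₁_X_right _ _)
    change bind₁ φ (C b⁻¹ * (X 0 - q')) = X 1
    rw [map_mul, map_sub, bind₁_C_right, bind₁_X_right, hφq']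
    change C b⁻¹ * (C b * X 1 + q - q) = X 1
    linear_combination X 1 * hCb
  refine ⟨ψ, hφψ, hψφ, rfl, ?_, rfl⟩
  exact C_mul_mem_supported _ (sub_mem (X_mem_supported.2 (by simp)) hq'_mem)

/-- In the coordinates `(b y + q(x), x, z)`, the automorphism
`(b y + q(x), c z + r(x, y), a x + p)` becomes a shift. -/
theorem HasDynamicalDegree.exists_of_inverse_cycle (hτ : IsDeJonquieres τ)
    (h : f.HasDynamicalDegree l) (hl : 1 < l) (h0 : f 0 = τ 1) (h1 : f 1 = τ 2) (h2 : f 2 = τ 0) :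
    ∃ i j : ℕ, l ^ 2 = i * l + j := by
  obtain ⟨a, b, c, -, hb, -, p, hp, q, hq, r, hr, hτ0, hτ1, hτ2⟩ := hτ.exists_eq_fin_three
  rw [hτ1] at h0
  rw [hτ2] at h1
  rw [hτ0] at h2
  obtain ⟨ψ, hφψ, hψφ, hψ0, hψ1, hψ2⟩ := exists_inverse_of_swap_shear hb hq
  have hfψ0 : bind₁ ψ (f 0) = X 0 := by
    rw [h0]
    exact congrFun hφψ 0
  have hψr : bind₁ ψ r ∈ supported k {0, 1} := by
    refine bind₁_mem_supported (S := {0, 1}) ?_ hr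
    rintro j (rfl | rfl)
    exacts [hψ0 ▸ X_mem_supported.2 (by simp), hψ1]
  have hψfq : bind₁ ψ (bind₁ f q) = q := by
    rw [bind₁_bind₁]
    exact bind₁_eq_self_of_mem_supported (S := {0}) (by simpa using hfψ0) hq
  have hψp : bind₁ ψ p = p := bind₁_eq_self_of_mem_supported (by simp) hp
  refine (h.conj hψφ hφψ).exists_of_shift hl (a := 1) (b := b * c) (c := a)
    (q := C b * bind₁ ψ r + q) (p := 0) one_ne_zero
    (add_mem (C_mul_mem_supported _ hψr) (supported_mono (by simp) hq)) (zero_mem _) hp ?_ ?_ ?_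
  · change bind₁ (comp f ψ) (C b * X 1 + q) = _
    rw [bind₁_comp]
    simp only [map_add, map_mul, bind₁_C_right, bind₁_X_right, h1, hψfq, hψ2]
    ring
  · change bind₁ (comp f ψ) (X 0) = _
    rw [bind₁_X_right, comp, hfψ0, C_1, one_mul, add_zero]
  · change bind₁ (comp f ψ) (X 2) = _
    rw [bind₁_X_right, comp, h2, map_add, map_mul, bind₁_C_right, bind₁_X_right, hψp, hψ0]

theorem IsDeJonquieres.isFibredHenon_swap_one_two (hτ : IsDeJonquieres τ) :
    IsFibredHenon (fun i => τ (Equiv.swap 1 2 i)) 1 where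
  base d (hd : coeff d (τ 0) ≠ 0) := by
    rcases hτ.coeff_cases hd with rfl | hd
    · simp
    · simp [hd]
  fst d hd := by
    rcases hτ.coeff_cases hd with rfl | hd
    · simp
    · exact Or.inr (hd 2 (by simp))
  snd d hd := by
    rcases hτ.coeff_cases hd with rfl | hd
    · simp
    · simp [hd]

theorem exists_eq_natCast_of_swap_one_two (hτ : IsDeJonquieres τ)
    (h : HasDynamicalDegree (fun i => τ (Equiv.swap 1 2 i)) l) (hl : 1 < l) : ∃ D : ℕ, l = D :=
  hτ.isFibredHenon_swap_one_two.exists_eq_natCast h hl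
    ⟨Finsupp.single 0 1, hτ.coeff_single 0, by simp⟩ (hτ.ne_zero _)

/-- The automorphism `(c z + r(x, y), b y + q(x), a x + p)` is fibred over the `y`-axis or a
recurrence, according to whether `q` is constant. -/
theorem HasDynamicalDegree.exists_of_transposition (hτ : IsDeJonquieres τ)
    (h : HasDynamicalDegree f l) (hl : 1 < l) (h0 : f 0 = τ 2) (h1 : f 1 = τ 1) (h2 : f 2 = τ 0) :
    ∃ i j : ℕ, l ^ 2 = i * l + j := by
  have fst (d) (hd : coeff d (f 0) ≠ 0) : (d 0 = 0 ∧ d 1 = 0 ∧ d 2 = 1) ∨ d 2 = 0 := by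
    rcases hτ.coeff_cases (h0 ▸ hd) with rfl | hd
    · simp
    · exact Or.inr (hd 2 le_rfl)
  have snd (d) (hd : coeff d (f 1) ≠ 0) :
      (d 0 = 0 ∧ d 1 = 1 ∧ d 2 = 0) ∨ (d 1 = 0 ∧ d 2 = 0) := by
    rcases hτ.coeff_cases (h1 ▸ hd) with rfl | hd
    · simp
    · exact Or.inr ⟨hd 1 le_rfl, hd 2 (by decide)⟩
  have thd (d) (hd : coeff d (f 2) ≠ 0) : d 0 ≤ 1 ∧ d 1 = 0 ∧ d 2 = 0 := by
    rcases hτ.coeff_cases (h2 ▸ hd) with rfl | hd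
    · simp
    · simp [hd]
  obtain ⟨e, he, he'⟩ := exists_max_exponent (h1 ▸ hτ.ne_zero 1 : f 1 ≠ 0) 0
  rcases Nat.eq_zero_or_pos e with rfl | hpos
  · have hf : IsFibredHenon f (Equiv.swap 0 1) := by
      refine ⟨fun d hd => ?_, fun d hd => ?_, fun d hd => ?_⟩
      · have := he d hd
        have := snd d hd
        change d 1 ≤ 1 ∧ d 0 = 0 ∧ d 2 = 0
        lia
      · have := fst d hd
        change (d 1 = 0 ∧ d 0 = 0 ∧ d 2 = 1) ∨ d 2 = 0
        lia
      · have := thd d hd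
        change (d 1 = 0 ∧ d 0 = 1 ∧ d 2 = 0) ∨ (d 0 = 0 ∧ d 2 = 0)
        lia
    obtain ⟨D, rfl⟩ := hf.exists_eq_natCast h hl
      ⟨Finsupp.single 1 1, h1 ▸ hτ.coeff_single 1, by simp⟩ (h0 ▸ hτ.ne_zero 2)
    exact ⟨D, 0, by simp [sq]⟩
  · refine IsRecurrent.exists_sq_eq ⟨hpos, fst, fun d hd => ?_, fun d hd => Or.inl (thd d hd)⟩
      h hl he'
    have := he d hd
    have := snd d hd
    lia

theorem dynamicalDegree_of_dim_three (h : f.HasDynamicalDegree l) (hf : IsAut f)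
    (hf' : IsAffineTriangular f) (hl : 1 < l) : ∃ i j : ℕ, l ^ 2 = i * l + j := by
  obtain ⟨τ, π, hτ, h'⟩ := h.exists_normalForm hf hf'
  have hπ : ∀ π : Equiv.Perm (Fin 3), π = 1 ∨ π = Equiv.swap 0 1 ∨ π = Equiv.swap 1 2 ∨
      π = Equiv.swap 0 2 ∨ π = finRotate 3 ∨ π = (finRotate 3)⁻¹ := by decide
  have of_natCast : (∃ D : ℕ, l = D) → ∃ i j : ℕ, l ^ 2 = i * l + j := by
    rintro ⟨D, rfl⟩
    exact ⟨D, 0, by simp [sq]⟩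
  rcases hπ π with rfl | rfl | rfl | rfl | rfl | rfl
  · exact absurd (hτ.dynamicalDegree_le_one h') (not_le.2 hl)
  · exact of_natCast (exists_eq_natCast_of_swap le_rfl hτ h' hl)
  · exact of_natCast (exists_eq_natCast_of_swap_one_two hτ h' hl)
  · exact h'.exists_of_transposition hτ hl rfl rfl rfl
  · exact h'.exists_of_inverse_cycle hτ hl rfl rfl rfl
  · exact h'.exists_of_cycle hτ hl rfl rfl rfl

end ThreeSpace

variable {n : ℕ}

theorem iter_monomial_ne_zero (m : Fin n → Fin n →₀ ℕ) (r : ℕ) (i : Fin n) :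
    iter (fun i => (monomial (m i) 1 : MvPolynomial (Fin n) k)) r i ≠ 0 := by
  induction r generalizing i with
  | zero => exact X_ne_zero i
  | succ r ih =>
    rw [iter, comp, bind₁_monomial, C_1, one_mul]
    exact Finset.prod_ne_zero_iff.2 fun j _ => pow_ne_zero _ (ih j)

theorem hasDynamicalDegree_of_monomial (hn : 1 ≤ n) {f : PolyEnd k n} {w : Fin n → ℝ}
    (hw : ∀ i, 0 < w i) {t : ℝ} (ht : 0 < t) {m : Fin n → Fin n →₀ ℕ}
    (hm : ∀ i, HasLeadingPart w (t * w i) (f i) (monomial (m i) 1)) :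
    f.HasDynamicalDegree t := by
  obtain ⟨C, hC, hd⟩ := exists_le_degree_iter ht (fun i => (hw i).le) hm (hw ⟨0, hn⟩)
    fun r => iter_monomial_ne_zero m r _
  obtain ⟨C', hC', hd'⟩ := exists_degree_iter_le ht.le hw fun i => (hm i).mem_Iic
  exact hasDynamicalDegree_of_bounds hC hC' ht.le hd hd'

end PolyEnd

section Realization

open PolyEnd

variable {k : Type*} [Field k] {n : ℕ}

theorem mem_realizingDims_of_weights (hn : 1 ≤ n) (π : Equiv.Perm (Fin n))
    {h : Fin n → MvPolynomial (Fin n) k} (hh : ∀ i, h i ∈ supported k (Set.Iio i))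
    {w : Fin n → ℝ} (hw : ∀ i, 0 < w i) {t : ℝ} (ht : 0 < t)
    (hlead : ∀ i, (h (π i) = 0 ∧ w (π i) = t * w i) ∨
      ∃ m, h (π i) = monomial m 1 ∧ Finsupp.weight w m = t * w i ∧ w (π i) < t * w i) :
    n ∈ realizingDims k t := by
  let τ : PolyEnd k n := fun i => X i + h i
  have hτ : IsDeJonquieres τ := fun i => ⟨1, one_ne_zero, h i, hh i, by simp [τ]⟩
  have hm (i : Fin n) : ∃ m, HasLeadingPart w (t * w i) (τ (π i)) (monomial m 1) := by
    rcases hlead i with ⟨h0, hwi⟩ | ⟨m, hm, hwm, hlt⟩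
    · have hX : τ (π i) = X (π i) := by simp only [τ, h0, add_zero]
      rw [hX, ← hwi]
      exact ⟨_, HasLeadingPart.X w _⟩
    · have hX : τ (π i) - monomial m 1 = X (π i) := by simp [τ, hm]
      exact ⟨m, monomial_mem_restrictWeight _ hwm, hX ▸ X_mem_restrictWeight hlt⟩
  choose m hm using hm
  refine ⟨hn, comp (perm k π) τ, (perm_isAut π).comp hτ.isAut,
    ⟨perm k π, τ, perm_isAffineAut hn π, hτ.isTriangular, rfl⟩, ?_⟩
  rw [perm_comp]
  exact hasDynamicalDegree_of_monomial hn hw ht hm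

theorem monomial_mem_supported {R σ : Type*} [CommSemiring R] {S : Set σ} {m : σ →₀ ℕ}
    (h : ∀ v, m v ≠ 0 → v ∈ S) (a : R) : monomial m a ∈ supported R S := by
  classical
  refine mem_supported_iff_coeff.2 fun d hd => ?_
  rw [coeff_monomial] at hd
  rwa [← (ite_ne_right_iff.1 hd).1]

theorem one_mem_realizingDims : 1 ∈ realizingDims k 1 :=
  mem_realizingDims_of_weights le_rfl 1 (h := 0) (fun _ => zero_mem _) (w := 1) (by simp) one_pos
    (by simp)

/-- The automorphism is `(y + x ^ D, x)`. -/
theorem two_mem_realizingDims {D : ℕ} (hD : 2 ≤ D) : 2 ∈ realizingDims k (D : ℝ) := by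
  have hD' : (2 : ℝ) ≤ D := by exact_mod_cast hD
  have hD0 : (0 : ℝ) < D := by linarith
  refine mem_realizingDims_of_weights (by norm_num) (Equiv.swap 0 1)
    (h := ![0, monomial (Finsupp.single 0 D) 1]) ?_ (w := ![D, 1]) ?_ hD0 ?_
  · simp only [Fin.forall_fin_two, Matrix.cons_val_zero, Matrix.cons_val_one]
    refine ⟨zero_mem _, monomial_mem_supported (fun v hv => ?_) 1⟩
    rw [Set.mem_Iio, Fin.lt_one_iff]
    by_contra hv0
    exact hv (Finsupp.single_eq_of_ne hv0)
  · simp [Fin.forall_fin_two, hD0]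
  · simp only [Fin.forall_fin_two, Equiv.swap_apply_left, Equiv.swap_apply_right,
      Matrix.cons_val_zero, Matrix.cons_val_one]
    exact ⟨Or.inr ⟨_, rfl, by simp [Finsupp.weight_single], by nlinarith⟩, Or.inl (by simp)⟩

/-- The automorphism is `(z + x ^ a * y ^ b, x, y)`, and the weights are `(l, 1, l⁻¹)`. -/
theorem three_mem_realizingDims {l : ℝ} (hl : 1 < l) {a b : ℕ} (h : l ^ 2 = a * l + b) :
    3 ∈ realizingDims k l := by
  have hl0 : 0 < l := by linarith
  have hl1 : l⁻¹ < 1 := inv_lt_one_of_one_lt₀ hl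
  let m : Fin 3 →₀ ℕ := Finsupp.single 0 a + Finsupp.single 1 b
  have hm2 : m 2 = 0 := by simp [m]
  have hweight : Finsupp.weight ![l, 1, l⁻¹] m = l * l := by
    simp only [m, map_add, Finsupp.weight_single, Matrix.cons_val_zero, Matrix.cons_val_one,
      nsmul_eq_mul, mul_one]
    linarith
  refine mem_realizingDims_of_weights (by norm_num) (finRotate 3).symm
    (h := ![0, 0, monomial m 1]) ?_ (w := ![l, 1, l⁻¹]) ?_ hl0 ?_
  · intro i
    fin_cases i
    · exact zero_mem _
    · exact zero_mem _
    · refine monomial_mem_supported (fun v hv => ?_) 1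
      fin_cases v
      exacts [by decide, by decide, (hv hm2).elim]
  · simp [Fin.forall_fin_succ, hl0]
  · have r0 : (finRotate 3).symm 0 = 2 := by decide
    have r1 : (finRotate 3).symm 1 = 0 := by decide
    have r2 : (finRotate 3).symm 2 = 1 := by decide
    intro i
    fin_cases i
    · exact Or.inr ⟨m, by simp [r0], hweight, by simpa [r0] using by nlinarith⟩
    · exact Or.inl (by simp [r1])
    · exact Or.inl (by simp [r2, hl0.ne'])

theorem add_self_mem_realizingDims {N : ℕ} (hN : 1 ≤ N) {l : ℝ} (hl : 1 < l)
    (M : Matrix (Fin N) (Fin N) ℕ) {u : Fin N → ℝ} (hu : ∀ i, 0 < u i)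
    (hM : ∀ i, ∑ j, M i j * u j = l * u i) : N + N ∈ realizingDims k l := by
  have hl0 : 0 < l := by linarith
  have hl1 : l⁻¹ < 1 := inv_lt_one_of_one_lt₀ hl
  let m (i : Fin N) : Fin (N + N) →₀ ℕ := Finsupp.equivFunOnFinite.symm (Fin.append (M i) 0)
  have hm_right (i j : Fin N) : m i (Fin.natAdd N j) = 0 := Fin.append_right _ _ j
  have hweight (i : Fin N) :
      Finsupp.weight (Fin.append u fun i => l⁻¹ * u i) (m i) = l * u i := by
    rw [Finsupp.weight_eq_sum, Fin.sum_univ_add]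
    simp [m, hM, -Fin.natAdd_eq_addNat]
  refine mem_realizingDims_of_weights (by lia) finAddFlip
    (h := Fin.append 0 fun i => monomial (m i) 1) (fun i => ?_)
    (w := Fin.append u fun i => l⁻¹ * u i) (fun i => ?_) hl0 fun i => ?_
  all_goals induction i using Fin.addCases with | left i => ?_ | right i => ?_
  · rw [Fin.append_left]
    exact zero_mem _
  · rw [Fin.append_right]
    refine monomial_mem_supported (fun v hv => ?_) 1
    induction v using Fin.addCases with
    | left v =>
      rw [Set.mem_Iio, Fin.lt_def, Fin.val_castAdd, Fin.val_natAdd]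
      lia
    | right v => exact (hv (hm_right i v)).elim
  · rw [Fin.append_left]
    exact hu i
  · rw [Fin.append_right]
    exact mul_pos (inv_pos.2 hl0) (hu i)
  · simp only [finAddFlip_apply_castAdd, Fin.append_right, Fin.append_left]
    exact Or.inr ⟨m i, rfl, hweight i, by nlinarith [hu i]⟩
  · simp only [finAddFlip_apply_natAdd, Fin.append_right, Fin.append_left]
    exact Or.inl ⟨rfl, by rw [mul_inv_cancel_left₀ hl0.ne']⟩

end Realization

section MaximalModulus

theorem algEquiv_prod_eq_prod {K L : Type*} [Field K] [NormedField L] [Algebra K L] {x : L}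
    (hx : x ≠ 0) (hmax : ∀ y, IsConjRoot K x y → ‖y‖ ≤ ‖x‖) {s : Finset L}
    (hs : ∀ y, y ∈ s ↔ IsConjRoot K x y ∧ ‖y‖ = ‖x‖) (σ : L ≃ₐ[K] L)
    (hσ : ‖σ (∏ y ∈ s, y)‖ = ‖x‖ ^ s.card) : σ (∏ y ∈ s, y) = ∏ y ∈ s, y := by
  classical
  have hconj (y : L) (hy : y ∈ s) : IsConjRoot K x (σ y) :=
    ((hs y).1 hy).1.trans (isConjRoot_of_algEquiv y σ)
  have hnorm (y : L) (hy : y ∈ s) : ‖σ y‖ = ‖x‖ := by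
    by_contra hne
    have hlt : ∏ y ∈ s, ‖σ y‖ < ∏ _y ∈ s, ‖x‖ :=
      Finset.prod_lt_prod
        (fun z hz => norm_pos_iff.2 ((map_ne_zero σ).2 (((hs z).1 hz).1.ne_zero hx)))
        (fun z hz => hmax _ (hconj z hz)) ⟨y, hy, (hmax _ (hconj y hy)).lt_of_ne hne⟩
    rw [Finset.prod_const, ← hσ, map_prod, norm_prod] at hlt
    exact hlt.false
  have himage : s.image σ = s := by
    refine Finset.eq_of_subset_of_card_le (Finset.image_subset_iff.2 fun y hy => ?_)
      (Finset.card_image_of_injective s σ.injective).ge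
    exact (hs _).2 ⟨hconj y hy, hnorm y hy⟩
  conv_rhs => rw [← himage]
  rw [map_prod, Finset.prod_image σ.injective.injOn]

section AlgebraicClosure

variable {K : Type*} [Field K] [Algebra K ℝ] [Algebra K ℂ] [IsScalarTower K ℝ ℂ] {l : ℝ}
  {x : algebraicClosure K ℂ}

theorem prod_sq_eq_pow (hl : 0 < l) (hx : (x : ℂ) = l) (hmax : ∀ y, IsConjRoot K x y → ‖y‖ ≤ ‖x‖)
    {s : Finset (algebraicClosure K ℂ)} (hs : ∀ y, y ∈ s ↔ IsConjRoot K x y ∧ ‖y‖ = ‖x‖) :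
    (∏ y ∈ s, y) ^ 2 = x ^ (2 * s.card) := by
  have hxl : ‖x‖ = l := (congrArg norm hx).trans (Complex.norm_of_nonneg hl.le)
  have hx0 : x ≠ 0 := norm_pos_iff.1 (hxl ▸ hl)
  set p := ∏ y ∈ s, y
  have hpnorm : ‖p‖ = ‖x‖ ^ s.card := by
    rw [norm_prod, Finset.prod_congr rfl fun y hy => ((hs y).1 hy).2, Finset.prod_const]
  let conj := (Complex.conjAe.restrictScalars K).restrictNormal (algebraicClosure K ℂ)
  have hconj (y : algebraicClosure K ℂ) : (conj y : ℂ) = starRingEnd ℂ y :=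
    AlgEquiv.restrictNormal_commutes _ _ y
  have hconjp : conj p = p := by
    refine algEquiv_prod_eq_prod hx0 hmax hs conj (.trans ?_ hpnorm)
    exact (congrArg norm (hconj p)).trans (Complex.norm_conj _)
  have hmul : (p : ℂ) * p = ((‖p‖ ^ 2 : ℝ) : ℂ) := by
    nth_rw 2 [← hconjp]
    rw [hconj, Complex.mul_conj, Complex.normSq_eq_norm_sq]
    rfl
  apply Subtype.ext
  push_cast
  rw [sq, hmul, hpnorm, hxl, hx]
  push_cast
  ring

/-- The product `p` of the conjugates of maximal modulus satisfies `p ^ 2 = x ^ m`. If `σ x` has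
maximal modulus, then so does each factor of `σ p`, and `σ` fixes `p`. -/
theorem exists_pow_eq_pow_of_isConjRoot_algebraicClosure (hl : 0 < l) (hx : (x : ℂ) = l)
    (hmax : ∀ y, IsConjRoot K x y → ‖y‖ ≤ l) :
    ∃ m : ℕ, 0 < m ∧ ∀ y, IsConjRoot K x y → ‖y‖ = l → y ^ m = x ^ m := by
  classical
  have hxl : ‖x‖ = l := (congrArg norm hx).trans (Complex.norm_of_nonneg hl.le)
  have hx0 : x ≠ 0 := norm_pos_iff.1 (hxl ▸ hl)
  obtain ⟨s, hs⟩ : ∃ s : Finset (algebraicClosure K ℂ),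
      ∀ y, y ∈ s ↔ IsConjRoot K x y ∧ ‖y‖ = ‖x‖ := by
    refine ⟨((minpoly K x).rootSet _).toFinset.filter fun y => ‖y‖ = ‖x‖, fun y => ?_⟩
    rw [Finset.mem_filter, Set.mem_toFinset, isConjRoot_iff_mem_minpoly_rootSet]
    exact (algebraicClosure.isAlgebraic K ℂ).isIntegral.isIntegral x
  rw [← hxl] at hmax
  have hpsq := prod_sq_eq_pow hl hx hmax hs
  set p := ∏ y ∈ s, y
  have hcard : 0 < s.card := Finset.card_pos.2 ⟨x, (hs x).2 ⟨.refl, rfl⟩⟩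
  refine ⟨2 * s.card, by lia, fun y hy hyl => ?_⟩
  obtain ⟨σ, rfl⟩ := hy.symm.exists_algEquiv
  have hσsq : σ p ^ 2 = σ x ^ (2 * s.card) := by rw [← map_pow, hpsq, map_pow]
  have hσp : σ p = p := by
    refine algEquiv_prod_eq_prod hx0 hmax hs σ ?_
    have := congrArg norm hσsq
    rw [norm_pow, norm_pow, hyl, ← hxl, mul_comm, pow_mul] at this
    exact (pow_left_inj₀ (norm_nonneg _) (by positivity) two_ne_zero).1 this
  rw [← hσsq, hσp, hpsq]

end AlgebraicClosure

theorem exists_pow_eq_pow_of_isConjRoot {K : Type*} [Field K] [Algebra K ℝ] [Algebra K ℂ]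
    [IsScalarTower K ℝ ℂ] {l : ℝ} (hl : 0 < l) (hint : IsIntegral K (l : ℂ))
    (hmax : ∀ μ : ℂ, IsConjRoot K (l : ℂ) μ → ‖μ‖ ≤ l) :
    ∃ m : ℕ, 0 < m ∧ ∀ μ : ℂ, IsConjRoot K (l : ℂ) μ → ‖μ‖ = l → μ ^ m = (l : ℂ) ^ m := by
  have hmem {μ : ℂ} (hμ : IsConjRoot K (l : ℂ) μ) : μ ∈ algebraicClosure K ℂ :=
    mem_algebraicClosure_iff'.2 (hμ.isIntegral hint)
  have hiff (y : algebraicClosure K ℂ) :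
      IsConjRoot K ⟨l, hmem .refl⟩ y ↔ IsConjRoot K (l : ℂ) y :=
    (isConjRoot_algHom_iff (algebraicClosure K ℂ).val).symm
  obtain ⟨m, hm, h⟩ := exists_pow_eq_pow_of_isConjRoot_algebraicClosure hl
    (x := ⟨l, hmem .refl⟩) rfl fun y hy => hmax y ((hiff y).1 hy)
  exact ⟨m, hm, fun μ hμ hμl => congrArg Subtype.val (h ⟨μ, hmem hμ⟩ ((hiff _).2 hμ) hμl)⟩

theorem isConjugateOf_iff_isConjRoot {l : ℝ} (hl : IsIntegral ℤ l) {μ : ℂ} :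
    IsConjugateOf μ l ↔ IsConjRoot ℚ (l : ℂ) μ := by
  have hP : minpoly ℚ (l : ℂ) = minpoly ℚ l :=
    minpoly.algebraMap_eq (algebraMap ℝ ℂ).injective l
  have hint : IsIntegral ℚ (l : ℂ) := (hl.map (algebraMap ℝ ℂ).toIntAlgHom).tower_top
  rw [isConjRoot_iff_aeval_eq_zero hint, hP, IsConjugateOf]

theorem IsWeakPerron.exists_pow_eq {l : ℝ} (hl : IsWeakPerron l) :
    ∃ m : ℕ, 0 < m ∧ ∀ μ : ℂ, IsConjugateOf μ l → ‖μ‖ = l → μ ^ m = (l : ℂ) ^ m := by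
  obtain ⟨hl1, hint, hconj⟩ := hl
  have hl0 : 0 < l := by linarith
  simp only [isConjugateOf_iff_isConjRoot hint] at hconj ⊢
  refine exists_pow_eq_pow_of_isConjRoot hl0
    (hint.map (algebraMap ℝ ℂ).toIntAlgHom).tower_top fun μ hμ => ?_
  by_cases hμl : μ = l
  · exact (hμl ▸ Complex.norm_of_nonneg hl0.le).le
  · exact hconj μ hμ hμl

end MaximalModulus

section Semigroup

theorem abs_ediv_succ_sub_ediv_sub_div_le (c : ℤ) (q i : ℕ) :
    |((((i + 1 : ℕ) * c / q - i * c / q : ℤ)) : ℝ) - c / q| ≤ 1 := by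
  have hfloor (j : ℕ) : (((j * c / q : ℤ)) : ℝ) = ⌊(j : ℝ) * (c / q)⌋ := by
    have hcast : (j : ℝ) * c = ((j * c : ℤ) : ℝ) := by push_cast; rfl
    rw [← mul_div_assoc, hcast, Int.floor_div_natCast, Int.floor_intCast]
  rw [Int.cast_sub, hfloor, hfloor, abs_le]
  push_cast
  have h := Int.floor_le ((i : ℝ) * (c / q))
  have h' := Int.lt_floor_add_one ((i : ℝ) * (c / q))
  have h₁ := Int.floor_le (((i : ℝ) + 1) * (c / q))
  have h₁' := Int.lt_floor_add_one (((i : ℝ) + 1) * (c / q))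
  constructor <;> linarith

/-- Rounding the multiples of each coefficient divided by `q` cuts `∑ s ∈ S, c s • s` into `q`
nearly equal parts, with an error that does not depend on `q`. -/
theorem exists_near_equal_parts {M E : Type*} [AddCommGroup M] [NormedAddCommGroup E]
    [NormedSpace ℝ E] (S : Finset M) (c : M → ℤ) {q : ℕ} (hq : 0 < q) :
    ∃ y : ℕ → M, (∀ i, y i ∈ Submodule.span ℤ (S : Set M)) ∧
      ∑ i ∈ Finset.range q, y i = ∑ s ∈ S, c s • s ∧
      ∀ (φ : M →+ E) (i : ℕ),
        ‖φ (y i) - (q : ℝ)⁻¹ • φ (∑ s ∈ S, c s • s)‖ ≤ ∑ s ∈ S, ‖φ s‖ := by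
  let F (i : ℕ) : M := ∑ s ∈ S, (i * c s / q) • s
  have hF (i : ℕ) : F i ∈ Submodule.span ℤ (S : Set M) :=
    Submodule.sum_mem _ fun s hs => Submodule.smul_mem _ _ (Submodule.subset_span hs)
  refine ⟨fun i => F (i + 1) - F i, fun i => Submodule.sub_mem _ (hF _) (hF _), ?_, fun φ i => ?_⟩
  · have hq' : (q : ℤ) ≠ 0 := by exact_mod_cast hq.ne'
    rw [Finset.sum_range_sub F q]
    simp [F, Int.mul_ediv_cancel_left _ hq']
  · have hsum : φ (F (i + 1) - F i) - (q : ℝ)⁻¹ • φ (∑ s ∈ S, c s • s) =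
        ∑ s ∈ S, ((((i + 1 : ℕ) * c s / q - i * c s / q : ℤ) : ℝ) - c s / q) • φ s := by
      simp only [F, map_sub, map_sum, map_zsmul, Finset.smul_sum, ← Finset.sum_sub_distrib]
      refine Finset.sum_congr rfl fun s _ => ?_
      rw [sub_smul, Int.cast_smul_eq_zsmul, sub_smul, div_eq_inv_mul, mul_smul,
        Int.cast_smul_eq_zsmul]
    rw [hsum]
    refine (norm_sum_le _ _).trans (Finset.sum_le_sum fun s _ => ?_)
    rw [norm_smul]
    exact mul_le_of_le_one_left (norm_nonneg _) (abs_ediv_succ_sub_ediv_sub_div_le (c s) q i)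

theorem exists_div_natCast_mem_Icc {R y : ℝ} (hR : 0 < R) (hy : R ≤ y) :
    ∃ q : ℕ, 0 < q ∧ y / q ∈ Set.Icc (R / 3) (R / 2) := by
  obtain ⟨x, rfl⟩ : ∃ x, y = x * R := ⟨y / R, (div_mul_cancel₀ y hR.ne').symm⟩
  have hx : 1 ≤ x := le_of_mul_le_mul_right (by linarith) hR
  have hceil : 2 * x ≤ ⌈2 * x⌉₊ := Nat.le_ceil _
  have hceil' : (⌈2 * x⌉₊ : ℝ) < 2 * x + 1 := Nat.ceil_lt_add_one (by linarith)
  refine ⟨⌈2 * x⌉₊, Nat.ceil_pos.2 (by linarith), ?_, ?_⟩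
  · rw [le_div_iff₀ (by linarith)]
    nlinarith
  · rw [div_le_iff₀ (by linarith)]
    nlinarith

theorem exists_contraction_factor {α : Type*} [Finite α] (f : α → ℝ) {r : ℝ} (hr : 0 < r) :
    ∃ ρ : ℝ, 0 ≤ ρ ∧ ρ < 1 ∧ ∀ a, f a < r → f a ≤ ρ * r := by
  have hev : ∀ᶠ ρ in nhdsWithin (1 : ℝ) (Set.Iio 1), ∀ a, f a < r → f a ≤ ρ * r := by
    refine Filter.eventually_all.2 fun a => ?_
    by_cases ha : f a < r
    · have : ∀ᶠ ρ : ℝ in nhdsWithin 1 (Set.Iio 1), f a / r < ρ :=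
        (eventually_gt_nhds ((div_lt_one hr).2 ha)).filter_mono nhdsWithin_le_nhds
      exact this.mono fun ρ hρ _ => ((div_lt_iff₀ hr).1 hρ).le
    · exact .of_forall fun ρ h => absurd h ha
  have hpos : ∀ᶠ ρ : ℝ in nhdsWithin 1 (Set.Iio 1), 0 < ρ :=
    (eventually_gt_nhds one_pos).filter_mono nhdsWithin_le_nhds
  obtain ⟨ρ, ⟨hρ, hρ0⟩, hρ1⟩ := ((hev.and hpos).and self_mem_nhdsWithin).exists
  exact ⟨ρ, hρ0.le, hρ1, hρ⟩

variable {K : Type*} [Field K]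

theorem map_eq_of_mem_adjoin {ι : K →+* ℝ} {β : K} {φ : K →+* ℂ} (h : φ β = ι β) {z : K}
    (hz : z ∈ Algebra.adjoin ℤ {β}) : φ z = ι z := by
  have heq : Set.EqOn φ (Complex.ofRealHom.comp ι) {β} := Set.eqOn_singleton.2 h
  exact AlgHom.eqOn_adjoin_iff (φ := φ.toIntAlgHom) (ψ := (Complex.ofRealHom.comp ι).toIntAlgHom)
    |>.2 heq hz

/-- The elements of a subgroup `A` of `K` whose image under the real embedding `ι` is positive, at
most `R`, and dominates the absolute values of all their complex conjugates. If `A` is an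
order and `R` is large, they form a finite set whose span over `ℕ` is stable under multiplication by
a dominant element. -/
def dominantElements (ι : K →+* ℝ) (A : Submodule ℤ K) (R : ℝ) : Set K :=
  {z | z ∈ A ∧ 0 < ι z ∧ ι z ≤ R ∧ ∀ φ : K →+* ℂ, ‖φ z‖ ≤ ι z}

/-- If `R < ι y`, cut `y` into nearly equal parts `z` with `R / 3 - B ≤ ι z ≤ R / 2 + B`. -/
theorem mem_span_dominantElements {ι : K →+* ℝ} {S : Finset K} {B R ρ : ℝ}
    (hB : ∀ φ : K →+* ℂ, ∑ s ∈ S, ‖φ s‖ ≤ B) (hR : 6 * B < R)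
    (hρR : 6 * B ≤ (1 - ρ) * R) {y : K} (hy : y ∈ Submodule.span ℤ (S : Set K)) (hy0 : 0 < ι y)
    (hyφ : ∀ φ : K →+* ℂ, (∀ z ∈ Submodule.span ℤ (S : Set K), φ z = ι z) ∨ ‖φ y‖ ≤ ρ * ι y) :
    y ∈ Submodule.span ℕ (dominantElements ι (Submodule.span ℤ S) R) := by
  let φ₀ : K →+* ℂ := Complex.ofRealHom.comp ι
  have hB0 : 0 ≤ B := (Finset.sum_nonneg fun _ _ => norm_nonneg _).trans (hB φ₀)
  have hρ1 : ρ ≤ 1 := by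
    by_contra! h
    nlinarith
  have hmem {z : K} (hz : z ∈ Submodule.span ℤ (S : Set K)) (hz0 : 0 < ι z) (hzR : ι z ≤ R)
      (hzφ : ∀ φ : K →+* ℂ, ‖φ y‖ ≤ ρ * ι y → ‖φ z‖ ≤ ι z) :
      z ∈ dominantElements ι (Submodule.span ℤ S) R := by
    refine ⟨hz, hz0, hzR, fun φ => (hyφ φ).elim (fun h => ?_) (hzφ φ)⟩
    rw [h z hz, Complex.norm_of_nonneg hz0.le]
  rcases le_or_gt (ι y) R with hle | hgt
  · exact Submodule.subset_span (hmem hy hy0 hle fun φ h => h.trans (by nlinarith))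
  obtain ⟨q, hq, hqR⟩ := exists_div_natCast_mem_Icc (by linarith) hgt.le
  obtain ⟨c, -, hc⟩ := Submodule.mem_span_finset.1 hy
  obtain ⟨p, hpS, hpsum, hpφ⟩ := exists_near_equal_parts (E := ℂ) S c hq
  rw [hc] at hpsum hpφ
  rw [← hpsum]
  refine Submodule.sum_mem _ fun i _ => Submodule.subset_span ?_
  have hpart (φ : K →+* ℂ) : ‖φ (p i) - (q : ℝ)⁻¹ • φ y‖ ≤ B :=
    (hpφ φ.toAddMonoidHom i).trans (hB φ)
  obtain ⟨hlower, hupper⟩ : -B ≤ ι (p i) - ι y / q ∧ ι (p i) - ι y / q ≤ B := by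
    have hreal : φ₀ (p i) - (q : ℝ)⁻¹ • φ₀ y = ((ι (p i) - ι y / q : ℝ) : ℂ) := by
      simp [φ₀, div_eq_inv_mul]
    rw [← abs_le, ← Real.norm_eq_abs, ← Complex.norm_real, ← hreal]
    exact hpart φ₀
  refine hmem (hpS i) (by linarith [hqR.1]) (by linarith [hqR.2]) fun φ h => ?_
  calc ‖φ (p i)‖
    _ ≤ ‖(q : ℝ)⁻¹ • φ y‖ + ‖φ (p i) - (q : ℝ)⁻¹ • φ y‖ := norm_le_norm_add_norm_sub' _ _
    _ ≤ ρ * (ι y / q) + B := by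
      refine add_le_add ?_ (hpart φ)
      rw [norm_smul, norm_inv, Real.norm_natCast, ← mul_div_assoc, div_eq_inv_mul]
      gcongr
    _ ≤ ι (p i) := by nlinarith [hqR.1]

theorem dominantElements_finite [NumberField K] (ι : K →+* ℝ) {β : K} (hβ : IsIntegral ℤ β)
    (R : ℝ) : (dominantElements ι (Subalgebra.toSubmodule (Algebra.adjoin ℤ {β})) R).Finite := by
  refine (NumberField.Embeddings.finite_of_norm_le K ℂ R).subset ?_
  rintro z ⟨hz, -, hzR, hzφ⟩
  exact ⟨adjoin_le_integralClosure hβ hz, fun φ => (hzφ φ).trans hzR⟩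

theorem exists_finset_mul_mem_span [NumberField K] (ι : K →+* ℝ) {β : K} (hβ : IsIntegral ℤ β)
    (hpos : 0 < ι β) (hdom : ∀ φ : K →+* ℂ, φ β = ι β ∨ ‖φ β‖ < ι β) :
    ∃ F : Finset K, F.Nonempty ∧ (∀ z ∈ F, 0 < ι z) ∧
      ∀ z ∈ F, β * z ∈ Submodule.span ℕ (F : Set K) := by
  obtain ⟨ρ, hρ0, hρ1, hρ⟩ := exists_contraction_factor (fun φ : K →+* ℂ => ‖φ β‖) hpos
  obtain ⟨S, hS⟩ := hβ.fg_adjoin_singleton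
  obtain ⟨B, hB⟩ : ∃ B : ℝ, ∀ φ : K →+* ℂ, ∑ s ∈ S, ‖φ s‖ ≤ B := by
    obtain ⟨B, hB⟩ := (Set.finite_range fun φ : K →+* ℂ => ∑ s ∈ S, ‖φ s‖).bddAbove
    exact ⟨B, fun φ => hB ⟨φ, rfl⟩⟩
  obtain ⟨R, hR1, hRB, hRρ⟩ : ∃ R : ℝ, 1 ≤ R ∧ 6 * B < R ∧ 6 * B ≤ (1 - ρ) * R := by
    have := (Filter.tendsto_id.const_mul_atTop (sub_pos.2 hρ1)).eventually_ge_atTop (6 * B)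
    exact ((Filter.eventually_ge_atTop 1).and
      ((Filter.eventually_gt_atTop (6 * B)).and this)).exists
  have hfin := dominantElements_finite ι hβ R
  refine ⟨hfin.toFinset, ⟨1, ?_⟩, fun z hz => ?_, fun z hz => ?_⟩
  · rw [Set.Finite.mem_toFinset]
    exact ⟨one_mem (Algebra.adjoin ℤ {β}), by simp, by simpa using hR1, by simp⟩
  all_goals obtain ⟨hzA, hz0, -, hzφ⟩ := hfin.mem_toFinset.1 hz
  · exact hz0
  · rw [Set.Finite.coe_toFinset, ← hS]
    refine mem_span_dominantElements hB hRB hRρ ?_ ?_ fun φ =>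
      (hdom φ).imp (fun h y hy => ?_) fun h => ?_
    · rw [hS]
      exact Subalgebra.mul_mem _ (Algebra.self_mem_adjoin_singleton ℤ β) hzA
    · rw [map_mul]
      exact mul_pos hpos hz0
    · rw [hS] at hy
      exact map_eq_of_mem_adjoin h hy
    · rw [map_mul, map_mul, norm_mul, ← mul_assoc]
      exact mul_le_mul (hρ φ h) (hzφ φ) (norm_nonneg _) (by positivity)

end Semigroup

section Matrix

theorem exists_finset_mul_mem_span_of_pow {R : Type*} [CommSemiring R] (x : R) {m : ℕ}
    (hm : 0 < m) {F : Finset R} (hF : ∀ z ∈ F, x ^ m * z ∈ Submodule.span ℕ (F : Set R)) :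
    ∃ U : Finset R, F ⊆ U ∧ (∀ u ∈ U, ∃ t, ∃ z ∈ F, u = x ^ t * z) ∧
      ∀ u ∈ U, x * u ∈ Submodule.span ℕ (U : Set R) := by
  classical
  let U : Finset R := Finset.image₂ (fun t z => x ^ t * z) (Finset.range m) F
  have hmem {t : ℕ} (ht : t < m) {z : R} (hz : z ∈ F) : x ^ t * z ∈ U :=
    Finset.mem_image₂_of_mem (Finset.mem_range.2 ht) hz
  have hsub : F ⊆ U := fun z hz => by simpa using hmem hm hz
  refine ⟨U, hsub, fun u hu => ?_, fun u hu => ?_⟩ <;>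
    obtain ⟨t, ht, z, hz, rfl⟩ := Finset.mem_image₂.1 hu
  · exact ⟨t, z, hz, rfl⟩
  rw [← mul_assoc, ← pow_succ']
  rcases (Nat.succ_le_of_lt (Finset.mem_range.1 ht)).lt_or_eq with hlt | rfl
  · exact Submodule.subset_span (hmem hlt hz)
  · exact Submodule.span_mono hsub (hF z hz)

theorem exists_matrix_mul_eq {R : Type*} [CommSemiring R] {x : R} {U : Finset R}
    (hU : ∀ u ∈ U, x * u ∈ Submodule.span ℕ (U : Set R)) :
    ∃ (M : Matrix (Fin U.card) (Fin U.card) ℕ) (u : Fin U.card → R), (∀ i, u i ∈ U) ∧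
      ∀ i, ∑ j, M i j * u j = x * u i := by
  have hcoeff (u : U) : ∃ f : R → ℕ, ∑ a ∈ U, f a • a = x * u := by
    obtain ⟨f, -, hf⟩ := Submodule.mem_span_finset.1 (hU u u.2)
    exact ⟨f, hf⟩
  choose f hf using hcoeff
  refine ⟨.of fun i j => f (U.equivFin.symm i) (U.equivFin.symm j),
    fun i => U.equivFin.symm i, fun i => (U.equivFin.symm i).2, fun i => ?_⟩
  rw [← hf, ← Finset.sum_coe_sort U, ← U.equivFin.symm.sum_comp]
  simp only [Matrix.of_apply, nsmul_eq_mul]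

open IntermediateField in
theorem isConjugateOf_map_gen {l : ℝ} (φ : ℚ⟮l⟯ →+* ℂ) :
    IsConjugateOf (φ (AdjoinSimple.gen ℚ l)) l := by
  have h := Polynomial.aeval_algHom_apply φ.toRatAlgHom (AdjoinSimple.gen ℚ l) (minpoly ℚ l)
  have hgen : Polynomial.aeval (AdjoinSimple.gen ℚ l) (minpoly ℚ l) = 0 :=
    aeval_gen_minpoly ℚ l
  rwa [hgen, map_zero] at h

open IntermediateField in
theorem IsWeakPerron.exists_finset_pow_mul_mem_span {l : ℝ} (hl : IsWeakPerron l) :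
    ∃ (m : ℕ) (F : Finset ℝ), 0 < m ∧ F.Nonempty ∧ (∀ z ∈ F, 0 < z) ∧
      ∀ z ∈ F, l ^ m * z ∈ Submodule.span ℕ (F : Set ℝ) := by
  classical
  obtain ⟨m, hm, hpow⟩ := hl.exists_pow_eq
  obtain ⟨hl1, hint, hconj⟩ := hl
  have hfd := adjoin.finiteDimensional (K := ℚ) (hint.tower_top : IsIntegral ℚ l)
  have : NumberField ℚ⟮l⟯ := {}
  let ι : ℚ⟮l⟯ →+* ℝ := algebraMap ℚ⟮l⟯ ℝ
  let g : ℚ⟮l⟯ := AdjoinSimple.gen ℚ l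
  have hιg : ι g = l := AdjoinSimple.coe_gen ℚ l
  have hg : IsIntegral ℤ g := by
    rw [← isIntegral_algebraMap_iff (algebraMap ℚ⟮l⟯ ℝ).injective]
    exact hιg.symm ▸ hint
  have hdom (φ : ℚ⟮l⟯ →+* ℂ) : φ (g ^ m) = ι (g ^ m) ∨ ‖φ (g ^ m)‖ < ι (g ^ m) := by
    have hφ : IsConjugateOf (φ g) l := isConjugateOf_map_gen φ
    rw [map_pow, map_pow, hιg, norm_pow, Complex.ofReal_pow]
    by_cases h : φ g = l
    · exact Or.inl (h ▸ rfl)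
    · exact (hconj _ hφ h).eq_or_lt.imp (hpow _ hφ) fun hlt =>
        pow_lt_pow_left₀ hlt (norm_nonneg _) hm.ne'
  obtain ⟨F, hF, hFpos, hFmul⟩ := exists_finset_mul_mem_span ι (hg.pow m)
    (by rw [map_pow, hιg]; positivity) hdom
  refine ⟨m, F.image ι, hm, hF.image ι, Finset.forall_mem_image.2 hFpos,
    Finset.forall_mem_image.2 fun z hz => ?_⟩
  have h := Submodule.mem_map_of_mem (f := ι.toAddMonoidHom.toNatLinearMap) (hFmul z hz)
  rw [Submodule.map_span] at h
  have hmap : ι.toAddMonoidHom.toNatLinearMap (g ^ m * z) = l ^ m * ι z := by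
    change ι (g ^ m * z) = _
    rw [map_mul, map_pow, hιg]
  rw [Finset.coe_image, ← hmap]
  exact h

theorem IsWeakPerron.exists_matrix {l : ℝ} (hl : IsWeakPerron l) :
    ∃ (N : ℕ) (M : Matrix (Fin N) (Fin N) ℕ) (u : Fin N → ℝ), 1 ≤ N ∧ (∀ i, 0 < u i) ∧
      ∀ i, ∑ j, M i j * u j = l * u i := by
  obtain ⟨m, F, hm, hF, hFpos, hFmul⟩ := hl.exists_finset_pow_mul_mem_span
  obtain ⟨U, hFU, hUF, hUmul⟩ := exists_finset_mul_mem_span_of_pow l hm hFmul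
  obtain ⟨M, u, hu, hM⟩ := exists_matrix_mul_eq hUmul
  refine ⟨U.card, M, u, (hF.mono hFU).card_pos, fun i => ?_, hM⟩
  obtain ⟨t, z, hz, hui⟩ := hUF _ (hu i)
  rw [hui]
  exact mul_pos (pow_pos (by linarith [hl.1]) t) (hFpos z hz)

end Matrix

section LeastDimension

variable {k : Type*} [Field k]

theorem IsWeakPerron.realizingDims_nonempty {l : ℝ} (hl : IsWeakPerron l) :
    (realizingDims k l).Nonempty := by
  rcases hl.1.eq_or_lt with rfl | h1
  · exact ⟨1, one_mem_realizingDims⟩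
  · obtain ⟨N, M, u, hN, hu, hM⟩ := hl.exists_matrix
    exact ⟨N + N, add_self_mem_realizingDims hN h1 M hu hM⟩

theorem two_le_of_mem_realizingDims {l : ℝ} (h1 : 1 < l) {n : ℕ} (hn : n ∈ realizingDims k l) :
    2 ≤ n := by
  obtain ⟨hn1, f, hf, hf', hd⟩ := hn
  by_contra hlt
  obtain rfl : n = 1 := by lia
  exact (PolyEnd.dynamicalDegree_le_one_of_dim_one hd hf hf').not_gt h1

theorem three_le_of_mem_realizingDims {l : ℝ} (h1 : 1 < l) (hl : ∀ D : ℕ, l ≠ D) {n : ℕ}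
    (hn : n ∈ realizingDims k l) : 3 ≤ n := by
  have h2 := two_le_of_mem_realizingDims h1 hn
  obtain ⟨-, f, hf, hf', hd⟩ := hn
  by_contra hlt
  obtain rfl : n = 2 := by lia
  obtain ⟨D, hD⟩ := PolyEnd.dynamicalDegree_of_dim_two hd hf hf' h1
  exact hl D hD

theorem four_le_of_mem_realizingDims {l : ℝ} (h1 : 1 < l) (hl : ∀ D : ℕ, l ≠ D)
    (hl' : ∀ i j : ℕ, l ^ 2 ≠ i * l + j) {n : ℕ} (hn : n ∈ realizingDims k l) : 4 ≤ n := by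
  have h3 := three_le_of_mem_realizingDims h1 hl hn
  obtain ⟨-, f, hf, hf', hd⟩ := hn
  by_contra hlt
  obtain rfl : n = 3 := by lia
  obtain ⟨i, j, hij⟩ := PolyEnd.dynamicalDegree_of_dim_three hd hf hf' h1
  exact hl' i j hij

theorem IsQuadraticInteger.ne_natCast {l : ℝ} (hl : IsQuadraticInteger l) (D : ℕ) : l ≠ D := by
  rintro rfl
  have hD : minpoly ℚ (D : ℝ) = Polynomial.X - Polynomial.C (D : ℚ) := by
    have := minpoly.eq_X_sub_C ℝ (D : ℚ)
    rwa [map_natCast] at this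
  have h2 := hl.2
  rw [hD, Polynomial.natDegree_X_sub_C] at h2
  lia

theorem aeval_minpoly_eq_zero_of_isConjugateOf {l μ : ℝ} (hμ : IsConjugateOf (μ : ℂ) l) :
    Polynomial.aeval μ (minpoly ℚ l) = 0 :=
  (map_eq_zero (algebraMap ℝ ℂ)).1 ((Polynomial.aeval_algebraMap_apply ℂ μ _).symm.trans hμ)

theorem add_eq_and_mul_eq_of_roots {F : Type*} [CommRing F] [IsDomain F] {x y b c : F} (hne : y ≠ x)
    (hx : x ^ 2 = b * x + c) (hy : y ^ 2 = b * y + c) : x + y = b ∧ x * y = -c := by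
  have hadd : x + y = b := by
    refine mul_left_cancel₀ (sub_ne_zero.2 hne.symm) ?_
    linear_combination hx - hy
  exact ⟨hadd, by linear_combination x * hadd - hx⟩

theorem IsQuadraticInteger.exists_sq_eq {l : ℝ} (hl : IsQuadraticInteger l) :
    ∃ b c : ℤ, ∀ x : ℝ, Polynomial.aeval x (minpoly ℚ l) = 0 → x ^ 2 = b * x + c := by
  have hmap : minpoly ℚ l = (minpoly ℤ l).map (algebraMap ℤ ℚ) :=
    minpoly.isIntegrallyClosed_eq_field_fractions' ℚ hl.1
  have hmonic := minpoly.monic hl.1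
  have hdeg : (minpoly ℤ l).natDegree = 2 := by
    rw [← hl.2, hmap, hmonic.natDegree_map]
  have hlead : (minpoly ℤ l).coeff 2 = 1 := hdeg ▸ hmonic
  refine ⟨-(minpoly ℤ l).coeff 1, -(minpoly ℤ l).coeff 0, fun x hx => ?_⟩
  rw [hmap, Polynomial.aeval_map_algebraMap, Polynomial.aeval_eq_sum_range, hdeg] at hx
  simp only [Finset.sum_range_succ, Finset.sum_range_zero, zsmul_eq_mul, hlead] at hx
  push_cast at hx ⊢
  linear_combination hx

theorem IsQuadraticInteger.exists_trace_norm {l : ℝ} (hl : IsQuadraticInteger l) {μ : ℝ}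
    (hμ : IsConjugateOf (μ : ℂ) l) (hne : μ ≠ l) :
    ∃ a c : ℤ, l + μ = a ∧ l * μ = c := by
  obtain ⟨b, c, h⟩ := hl.exists_sq_eq
  obtain ⟨hadd, hmul⟩ := add_eq_and_mul_eq_of_roots hne (h l (minpoly.aeval ℚ l))
    (h μ (aeval_minpoly_eq_zero_of_isConjugateOf hμ))
  exact ⟨b, -c, hadd, by rw [hmul, Int.cast_neg]⟩

theorem mul_nonpos_of_sq_eq {l μ : ℝ} (hμ : IsConjugateOf (μ : ℂ) l) (hne : μ ≠ l) {i j : ℕ}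
    (h : l ^ 2 = i * l + j) : l * μ ≤ 0 := by
  have hroot (x : ℝ) : Polynomial.aeval x
      (Polynomial.X ^ 2 - Polynomial.C (i : ℚ) * Polynomial.X - Polynomial.C (j : ℚ)) =
        x ^ 2 - (i * x + j) := by
    simp only [map_sub, map_mul, map_pow, Polynomial.aeval_X, map_natCast]
    ring
  have hdvd := minpoly.dvd ℚ l ((hroot l).trans (sub_eq_zero.2 h))
  have hμroot := Polynomial.aeval_eq_zero_of_dvd_aeval_eq_zero hdvd
    (aeval_minpoly_eq_zero_of_isConjugateOf hμ)
  rw [hroot, sub_eq_zero] at hμroot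
  rw [(add_eq_and_mul_eq_of_roots hne h hμroot).2]
  exact neg_nonpos.2 (Nat.cast_nonneg j)

theorem three_mem_realizingDims_of_trace_norm {l μ : ℝ} (hl : 1 < l) (hμ : μ < 0) (hμl : |μ| ≤ l)
    {a c : ℤ} (ha : l + μ = a) (hc : l * μ = c) : 3 ∈ realizingDims k l := by
  have ha0 : 0 ≤ a := by
    have : (0 : ℝ) ≤ a := by linarith [neg_abs_le μ]
    exact_mod_cast this
  have hc0 : c ≤ 0 := by
    have : (c : ℝ) ≤ 0 := by nlinarith
    exact_mod_cast this
  lift a to ℕ using ha0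
  obtain ⟨b, rfl⟩ := Int.exists_eq_neg_ofNat hc0
  push_cast at ha hc
  exact three_mem_realizingDims hl (a := a) (b := b) (by linear_combination l * ha - hc)

theorem exists_add_eq_le_mul {a c : ℤ} (ha : 0 ≤ a) (hc : 4 * c ≤ a ^ 2) :
    ∃ p s : ℕ, (p + s : ℤ) = a ∧ p ≤ s ∧ c ≤ p * s := by
  obtain ⟨p, rfl | rfl⟩ := Int.even_or_odd' a
  · lift p to ℕ using by lia
    exact ⟨p, p, by ring, le_rfl, by nlinarith⟩
  · lift p to ℕ using by lia
    refine ⟨p, p + 1, by push_cast; ring, p.le_succ, ?_⟩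
    push_cast
    have : 4 * c ≤ 4 * (p * (p + 1) : ℤ) + 1 := hc.trans_eq (by ring)
    lia

/-- Split the trace as `p + s` with `p`, `s` nearly equal. Since `4 * c < a ^ 2`, the matrix
`!![p, 1; p * s - c, s]` has nonnegative entries, and its characteristic polynomial is that
of `l`. -/
theorem four_mem_realizingDims {l μ : ℝ} (hl : 1 < l) (hμ : 0 < μ) (hμl : μ < l) {a c : ℤ}
    (ha : l + μ = a) (hc : l * μ = c) : 4 ∈ realizingDims k l := by
  have ha0 : 0 ≤ a := by
    have : (0 : ℝ) ≤ a := by linarith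
    exact_mod_cast this
  have hdisc : 4 * c ≤ a ^ 2 := by
    have : (4 * c : ℝ) ≤ a ^ 2 := by
      rw [← ha, ← hc]
      nlinarith [sq_nonneg (l - μ)]
    exact_mod_cast this
  obtain ⟨p, s, hps, hle, hcps⟩ := exists_add_eq_le_mul ha0 hdisc
  obtain ⟨r, hr⟩ := Int.eq_ofNat_of_zero_le (sub_nonneg.2 hcps)
  have hr' : (p * s - c : ℝ) = r := by exact_mod_cast hr
  have hps' : (p + s : ℝ) = a := by exact_mod_cast hps
  have hpl : 0 < l - p := by
    have : (p : ℝ) ≤ s := by exact_mod_cast hle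
    linarith
  refine add_self_mem_realizingDims (N := 2) (by norm_num) hl !![p, 1; r, s]
    (u := ![1, l - p]) (Fin.forall_fin_two.2 ⟨one_pos, hpl⟩) (Fin.forall_fin_two.2 ⟨?_, ?_⟩)
  · simp
  · simp only [Fin.sum_univ_two, Matrix.of_apply, Matrix.cons_val_zero, Matrix.cons_val_one,
      mul_one, ← hr']
    linear_combination l * hps' - l * ha + hc

end LeastDimension

end AffineDyn

theorem theorem2 {k : Type*} [Field k] (l : ℝ) (hl : AffineDyn.IsWeakPerron l) :
    (AffineDyn.realizingDims k l).Nonempty ∧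
    (1 < l → (∃ m : ℤ, l = (m : ℝ)) → IsLeast (AffineDyn.realizingDims k l) 2) ∧
    (AffineDyn.IsQuadraticInteger l →
      ∀ μ : ℝ, AffineDyn.IsConjugateOf (μ : ℂ) l → μ ≠ l →
        (μ < 0 → IsLeast (AffineDyn.realizingDims k l) 3) ∧
        (0 < μ → IsLeast (AffineDyn.realizingDims k l) 4)) := by
  open AffineDyn in
  refine ⟨hl.realizingDims_nonempty, ?_, fun hq μ hμ hne => ?_⟩
  · rintro h1 ⟨m, rfl⟩
    have hm : 1 < m := by exact_mod_cast h1
    lift m to ℕ using by lia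
    rw [Int.cast_natCast] at h1 ⊢
    exact ⟨two_mem_realizingDims (by exact_mod_cast hm), fun n => two_le_of_mem_realizingDims h1⟩
  have h1 : 1 < l := hl.1.lt_of_ne' (by simpa using hq.ne_natCast 1)
  have hμl : |μ| ≤ l := by simpa using hl.2.2 μ hμ (by exact_mod_cast hne)
  obtain ⟨a, c, ha, hc⟩ := hq.exists_trace_norm hμ hne
  refine ⟨fun hneg => ⟨?_, fun n => ?_⟩, fun hpos => ⟨?_, fun n => ?_⟩⟩
  · exact three_mem_realizingDims_of_trace_norm h1 hneg hμl ha hc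
  · exact three_le_of_mem_realizingDims h1 hq.ne_natCast
  · exact four_mem_realizingDims h1 hpos (lt_of_le_of_ne ((le_abs_self μ).trans hμl) hne) ha hc
  · exact four_le_of_mem_realizingDims h1 hq.ne_natCast fun i j hij =>
      (mul_nonpos_of_sq_eq hμ hne hij).not_gt (mul_pos (one_pos.trans h1) hpos)
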